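/- Let $N_e, N_m \ge 1$ be integers and $B_2, P_m, \sigma_{mv}, \sigma_{me} > 0$. Let $\mathbf h_{mv} \in \mathbb C^{1\times N_m}$ be a nonzero (known) main channel, $\mathbf w_d = \mathbf h_{mv}^\dagger/|\mathbf h_{mv}|$, and let $\mathbf G_d \in \mathbb C^{N_m\times(N_m-1)}$ satisfy $\mathbf h_{mv}\mathbf G_d = 0$ and $\mathbf G_d^\dagger \mathbf G_d = \mathbf I_{N_m-1}$. Let the wiretap channel $\mathbf H_{me}$ be an $N_e\times N_m$ random matrix with i.i.d. $\mathcal{CN}(0,1)$ entries, and put $\mathbf h_1 = \mathbf H_{me}\mathbf w_d$, $\mathbf H_3 = \mathbf H_{me}\mathbf G_d$. Define the capacities $$C_{v,d} = B_2\log_2\Big(1+\frac{P_m}{N_m\sigma_{mv}^2}|\mathbf h_{mv}|^2\Big),\qquad C_{e,d} = B_2\log_2\det\Big(\mathbf I_{N_e} + P_m\mathbf h_1\mathbf h_1^\dagger\big(N_m\sigma_{me}^2\mathbf I_{N_e}+P_m\mathbf H_3\mathbf H_3^\dagger\big)^{-1}\Big),$$ the instantaneous secrecy rate $R_2 = [C_{v,d}-C_{e,d}]^+$,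 and, for a wiretap code rate $R_d$, the secrecy outage probability $P_{\mathrm{out}}(R_d) = \mathbb P(R_2 \le R_d)$ and the effective secrecy rate $\hat R_d(R_d) = \{1-P_{\mathrm{out}}(R_d)\}R_d$. Let $a_2 = N_m\sigma_{me}^2/P_m$ and $Z_2 = \mathbf h_1^\dagger(a_2\mathbf I_{N_e}+\mathbf H_3\mathbf H_3^\dagger)^{-1}\mathbf h_1$. Then the complementary distribution function of $Z_2$ is, for every $z\ge 0$, $$\mathbb P(Z_2 > z) = \mathbb P(Z_2\ge z) = F_{Z_2}(z) := e^{-a_2 z}\sum_{k=0}^{N_e-1}\frac{A_k(z)}{k!}(a_2 z)^k,\qquad A_k(z) = \frac{\sum_{n=0}^{N_e-k-1}\binom{N_m-1}{n}z^n}{(1+z)^{N_m-1}},$$ and for every $R_d$ with $0\le R_d\le C_{v,d}$, $$P_{\mathrm{out}}(R_d) = \mathbb P(C_{e,d}\ge C_{v,d}-R_d) = F_{Z_2}(\phi_2),\qquad \hat R_d(R_d) = \{1-F_{Z_2}(\phi_2)\}R_d,$$ where $\phi_2 = 2^{(C_{v,d}-R_d)/B_2}-1$ (which is $2^{C_{v,d}-R_d}-1$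 when rates are normalized by the bandwidth, i.e. $B_2=1$). -/

import Mathlib

open MeasureTheory ProbabilityTheory Matrix

noncomputable section

namespace DownlinkWiretap

/-- The standard circularly symmetric complex Gaussian law `CN(0,1)`: the law of `x + i y` with
`x`, `y` independent real Gaussians of mean `0` and variance `1/2`. -/
def complexGaussian : Measure ℂ :=
  ((gaussianReal 0 (1 / 2)).prod (gaussianReal 0 (1 / 2))).map
    fun p : ℝ × ℝ => (p.1 : ℂ) + (p.2 : ℂ) * Complex.I

/-- Rayleigh fading: the entries of the random matrix `H` are i.i.d. `CN(0,1)`. -/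
structure IsRayleigh {Ω : Type*} [MeasurableSpace Ω] {Ne Nm : ℕ}
    (H : Ω → Matrix (Fin Ne) (Fin Nm) ℂ) (μ : Measure Ω) : Prop where
  hasLaw : ∀ i j, HasLaw (fun ω => H ω i j) complexGaussian μ
  indep : iIndepFun (fun (p : Fin Ne × Fin Nm) (ω : Ω) => H ω p.1 p.2) μ

/-- The MRT precoder `w_d = h_mv† / |h_mv|` for the main-channel row vector `h_mv`. -/
def mrtVector {Nm : ℕ} (h : EuclideanSpace ℂ (Fin Nm)) : Fin Nm → ℂ :=
  fun j => star (h j) / (‖h‖ : ℂ)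

/-- `G_d` is an artificial-noise precoder for the main channel `h_mv`: its `Nm - 1` columns are
orthonormal and lie in the null space of the row vector `h_mv`. -/
structure IsNullspacePrecoder {Nm : ℕ} (h : EuclideanSpace ℂ (Fin Nm))
    (G : Matrix (Fin Nm) (Fin (Nm - 1)) ℂ) : Prop where
  orthonormal : Gᴴ * G = 1
  null : (fun j => h j) ᵥ* G = 0

/-- The downlink capacity of the main channel,
`C_{v,d} = B log₂ (1 + P / (Nm σ_mv²) |h_mv|²)`. -/
def mainCapacity {Nm : ℕ} (B P σmv : ℝ) (h : EuclideanSpace ℂ (Fin Nm)) : ℝ :=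
  B * Real.logb 2 (1 + P / (Nm * σmv ^ 2) * ‖h‖ ^ 2)

/-- The downlink capacity of the wiretap channel with realization `H` of `H_me`,
`C_{e,d} = B log₂ det (I + P h₁ h₁† (Nm σ_me² I + P H₃ H₃†)⁻¹)`,
where `h₁ = H w_d` and `H₃ = H G_d`. The determinant is a real number, so that the real part only
changes its type. -/
def eveCapacity {Ne Nm : ℕ} (B P σme : ℝ) (h : EuclideanSpace ℂ (Fin Nm))
    (G : Matrix (Fin Nm) (Fin (Nm - 1)) ℂ) (H : Matrix (Fin Ne) (Fin Nm) ℂ) : ℝ :=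
  let h₁ : Fin Ne → ℂ := H *ᵥ mrtVector h
  let H₃ : Matrix (Fin Ne) (Fin (Nm - 1)) ℂ := H * G
  B * Real.logb 2 (det ((1 : Matrix (Fin Ne) (Fin Ne) ℂ) +
    ((P : ℂ) • vecMulVec h₁ (star h₁)) *
      ((Nm * (σme : ℂ) ^ 2) • (1 : Matrix (Fin Ne) (Fin Ne) ℂ) +
        (P : ℂ) • (H₃ * H₃ᴴ))⁻¹)).re

/-- The instantaneous downlink secrecy rate `R₂ = [C_{v,d} - C_{e,d}]⁺`. -/
def secrecyRate {Ne Nm : ℕ} (B P σmv σme : ℝ) (h : EuclideanSpace ℂ (Fin Nm))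
    (G : Matrix (Fin Nm) (Fin (Nm - 1)) ℂ) (H : Matrix (Fin Ne) (Fin Nm) ℂ) : ℝ :=
  max (mainCapacity B P σmv h - eveCapacity B P σme h G H) 0

/-- The secrecy outage probability `P_out(R) = P(R₂ ≤ R)` of the wiretap code rate `R`. The main
channel `h_mv` is known to the transmitter; the probability is over the wiretap channel `H_me`. -/
def outageProb {Ω : Type*} [MeasurableSpace Ω] (μ : Measure Ω) {Ne Nm : ℕ} (B P σmv σme : ℝ)
    (h : EuclideanSpace ℂ (Fin Nm)) (G : Matrix (Fin Nm) (Fin (Nm - 1)) ℂ)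
    (H : Ω → Matrix (Fin Ne) (Fin Nm) ℂ) (R : ℝ) : ℝ :=
  μ.real {ω | secrecyRate B P σmv σme h G (H ω) ≤ R}

/-- The effective secrecy rate `(1 - P_out(R)) R`. -/
def effectiveSecrecyRate {Ω : Type*} [MeasurableSpace Ω] (μ : Measure Ω) {Ne Nm : ℕ}
    (B P σmv σme : ℝ) (h : EuclideanSpace ℂ (Fin Nm)) (G : Matrix (Fin Nm) (Fin (Nm - 1)) ℂ)
    (H : Ω → Matrix (Fin Ne) (Fin Nm) ℂ) (R : ℝ) : ℝ :=
  (1 - outageProb μ B P σmv σme h G H R) * R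

/-- `a₂ = Nm σ_me² / P`. -/
def a₂ (Nm : ℕ) (P σme : ℝ) : ℝ := Nm * σme ^ 2 / P

/-- `Z₂ = h₁† (a₂ I + H₃ H₃†)⁻¹ h₁` with `h₁ = H w_d` and `H₃ = H G_d`; this is a real number, so
that the real part only changes its type. -/
def Z₂ {Ne Nm : ℕ} (P σme : ℝ) (h : EuclideanSpace ℂ (Fin Nm))
    (G : Matrix (Fin Nm) (Fin (Nm - 1)) ℂ) (H : Matrix (Fin Ne) (Fin Nm) ℂ) : ℝ :=
  let h₁ : Fin Ne → ℂ := H *ᵥ mrtVector h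
  let H₃ : Matrix (Fin Ne) (Fin (Nm - 1)) ℂ := H * G
  (star h₁ ⬝ᵥ (((a₂ Nm P σme : ℂ) • (1 : Matrix (Fin Ne) (Fin Ne) ℂ) + H₃ * H₃ᴴ)⁻¹ *ᵥ h₁)).re

/-- `A_k(z) = (∑_{n=0}^{Ne-k-1} C(Nm-1, n) zⁿ) / (1 + z)^(Nm-1)`. -/
def A (Ne Nm k : ℕ) (z : ℝ) : ℝ :=
  (∑ n ∈ Finset.range (Ne - k), ((Nm - 1).choose n : ℝ) * z ^ n) / (1 + z) ^ (Nm - 1)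

/-- `F(z) = exp(-a z) ∑_{k=0}^{Ne-1} A_k(z) / k! (a z)^k`. -/
def F (Ne Nm : ℕ) (a z : ℝ) : ℝ :=
  Real.exp (-(a * z)) *
    ∑ k ∈ Finset.range Ne, A Ne Nm k z / (k.factorial : ℝ) * (a * z) ^ k

/-- `φ₂ = 2^((C_{v,d} - R) / B) - 1`; for rates normalized by the bandwidth (`B = 1`) this is
`2^(C_{v,d} - R) - 1`. -/
def φ₂ {Nm : ℕ} (B P σmv : ℝ) (h : EuclideanSpace ℂ (Fin Nm)) (R : ℝ) : ℝ :=
  (2 : ℝ) ^ ((mainCapacity B P σmv h - R) / B) - 1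

end DownlinkWiretap

end

namespace DownlinkWiretap

open Filter Topology
open scoped ComplexOrder ENNReal MatrixOrder

/-! Rotating the rows of the Rayleigh matrix by the unitary matrix `[w_d, G_d]` makes `h₁` and the
`m = Nm - 1` columns `c_j` of `H₃` independent standard Gaussian vectors, so the problem is the tail
of `h† M⁻¹ h` with `M = a I + ∑ c_j c_j†`.

For fixed `M`, substituting `h = M^{1/2} g` turns the quadratic form into `|g|²` and the Gaussian
weight into a constant times `det M · exp (-g† M g)` (`lintegral_gaussianVector_quadratic_form`). It
remains to average this weight over `M`. By unitary invariance `g` may be taken to be `√t e₀` with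
`t = |g|²`. The factor `exp (-t |c_j 0|²)` then tilts each column: its first coordinate acquires
variance `1 / (1 + t)`, at the cost of a factor `1 / (1 + t)` per column (`lintegral_det_mul_exp`).
The mean of `det M` under the tilted law uses only second moments: each column is a rank-one update,
whose mean effect is a variance-weighted sum of smaller principal minors. This yields the recursion
`meanMinorTilted`.

The result is a density in `t = r²`, up to a constant. Pascal's rule gives `F` a recursion in `Nm`,
and differentiating it reproduces the recursion of `meanMinorTilted` (`hasDerivAt_F`); hence `-F` is
an antiderivative of the radial density. The sphere constant is never computed: `F` is `1` at `0`,
where the tail has full mass.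

Outage is the event that `Z₂` reaches `φ₂`, because `C_{e,d} = B log₂ (1 + Z₂)` by the matrix
determinant lemma. -/

/-- The mean `k × k` principal minor of `a I + ∑_{j < m} c_j c_j†` when the `c_j` are independent
with uncorrelated centred coordinates of unit variance. -/
noncomputable def meanMinor (a : ℝ) : ℕ → ℕ → ℝ
  | 0, k => a ^ k
  | m + 1, k => meanMinor a m k + k * meanMinor a m (k - 1)

/-- The mean `(k + 1) × (k + 1)` principal minor of `a I + ∑_{j < m} c_j c_j†` when one of its
coordinates has variance `w` and the others have unit variance. -/
noncomputable def meanMinorTilted (a w : ℝ) : ℕ → ℕ → ℝ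
  | 0, k => a ^ (k + 1)
  | m + 1, k => meanMinorTilted a w m k + w * meanMinor a m k + k * meanMinorTilted a w m (k - 1)

/-! ### Recursion, derivative and limits of the closed form `F` -/

lemma F_zero_left (m : ℕ) (a z : ℝ) : F 0 m a z = 0 := by simp [F]

lemma F_one_right (n : ℕ) (a z : ℝ) :
    F n 1 a z = Real.exp (-(a * z)) * ∑ k ∈ Finset.range n, (a * z) ^ k / (k.factorial : ℝ) := by
  unfold F
  congr 1
  refine Finset.sum_congr rfl fun k hk => ?_
  have hk : k < n := Finset.mem_range.mp hk
  have : A n 1 k z = 1 := by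
    obtain ⟨d, rfl⟩ : ∃ d, n = k + d + 1 := ⟨n - k - 1, by omega⟩
    simp [A, show k + d + 1 - k = d + 1 by omega, Finset.sum_range_succ', Nat.choose_zero_succ]
  rw [this]; ring

/-- Pascal's rule on the binomial coefficients; the shifted half loses its top term, which lowers
the first index by one. -/
lemma A_succ_succ (n m k : ℕ) (hk : k ≤ n) {z : ℝ} (hz : 1 + z ≠ 0) :
    A (n + 1) (m + 2) k z = (A (n + 1) (m + 1) k z + z * A n (m + 1) k z) / (1 + z) := by
  unfold A
  simp only [show m + 2 - 1 = m + 1 by omega, show m + 1 - 1 = m by omega,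
    show n + 1 - k = n - k + 1 by omega]
  have h : ∑ j ∈ Finset.range (n - k + 1), ((m + 1).choose j : ℝ) * z ^ j =
      ∑ j ∈ Finset.range (n - k + 1), (m.choose j : ℝ) * z ^ j +
        z * ∑ j ∈ Finset.range (n - k), (m.choose j : ℝ) * z ^ j := by
    rw [Finset.sum_range_succ', Finset.sum_range_succ' _ (n - k), Finset.mul_sum]
    simp only [Nat.choose_succ_succ, Nat.cast_add, add_mul, Finset.sum_add_distrib]
    have : ∀ j, (m.choose j : ℝ) * z ^ (j + 1) = z * ((m.choose j : ℝ) * z ^ j) := fun j => by ring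
    simp only [this, Nat.choose_zero_right]
    ring
  rw [h]
  field_simp
  ring

lemma F_succ_succ (n m : ℕ) (a : ℝ) {z : ℝ} (hz : 1 + z ≠ 0) :
    F (n + 1) (m + 2) a z = (F (n + 1) (m + 1) a z + z * F n (m + 1) a z) / (1 + z) := by
  -- The added term `k = n` vanishes: its `A` is a sum over `range 0`.
  have h0 : ∑ k ∈ Finset.range n, A n (m + 1) k z / (k.factorial : ℝ) * (a * z) ^ k =
      ∑ k ∈ Finset.range (n + 1), A n (m + 1) k z / (k.factorial : ℝ) * (a * z) ^ k := by
    rw [Finset.sum_range_succ]; simp [A]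
  unfold F
  rw [h0, mul_left_comm, ← mul_add, mul_div_assoc, Finset.mul_sum (a := z),
    ← Finset.sum_add_distrib, Finset.sum_div]
  congr 1
  refine Finset.sum_congr rfl fun k hk => ?_
  rw [A_succ_succ n m k (by simpa [Nat.lt_succ_iff] using hk) hz]
  ring

/-- Both sides satisfy the same recursion in `m`. This increment is what the quotient rule leaves
undifferentiated in `hasDerivAt_F`. -/
lemma F_succ_sub (m : ℕ) (a : ℝ) {z : ℝ} (hz : 1 + z ≠ 0) (n : ℕ) :
    F (n + 1) (m + 1) a z - F n (m + 1) a z =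
      Real.exp (-(a * z)) * (z ^ n / n.factorial) * meanMinor a m n / (1 + z) ^ m := by
  induction m generalizing n with
  | zero =>
    rw [F_one_right, F_one_right, Finset.sum_range_succ]
    simp only [meanMinor, mul_pow]
    ring
  | succ m ih =>
    cases n with
    | zero =>
      have := ih 0
      simp only [F_zero_left, sub_zero] at this ⊢
      rw [F_succ_succ _ _ _ hz, this]
      simp only [F_zero_left, meanMinor]
      -- The truncated index `k - 1` at `k = 0` is harmless, since its coefficient is `k`.
      simp only [Nat.cast_zero, zero_mul, mul_zero, add_zero]
      field_simp
      ring
    | succ n =>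
      have h1 := ih n
      have h2 := ih (n + 1)
      rw [F_succ_succ _ _ _ hz, F_succ_succ _ _ _ hz]
      have e : (F (n + 1 + 1) (m + 1) a z + z * F (n + 1) (m + 1) a z) / (1 + z) -
          (F (n + 1) (m + 1) a z + z * F n (m + 1) a z) / (1 + z) =
          ((F (n + 1 + 1) (m + 1) a z - F (n + 1) (m + 1) a z) +
            z * (F (n + 1) (m + 1) a z - F n (m + 1) a z)) / (1 + z) := by ring
      rw [e, h1, h2, meanMinor, Nat.factorial_succ]
      have : (n.factorial : ℝ) ≠ 0 := by positivity
      simp only [Nat.add_sub_cancel]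
      push_cast
      field_simp
      ring

lemma hasDerivAt_F_zero (n : ℕ) (a z : ℝ) :
    HasDerivAt (F (n + 1) 1 a) (-(Real.exp (-(a * z)) * (z ^ n / n.factorial) * a ^ (n + 1))) z := by
  have hE : HasDerivAt (fun z : ℝ => Real.exp (-(a * z))) (Real.exp (-(a * z)) * -a) z := by
    have := (((hasDerivAt_id z).const_mul a).neg).exp
    simpa using this
  induction n with
  | zero =>
    have : F (0 + 1) 1 a = fun z => Real.exp (-(a * z)) := by
      funext z; simp [F_one_right]
    rw [this]
    convert hE using 1
    simp
  | succ n ih =>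
    have : F (n + 1 + 1) 1 a = fun z => F (n + 1) 1 a z +
        Real.exp (-(a * z)) * ((a * z) ^ (n + 1) / ((n + 1).factorial : ℝ)) := by
      funext z; rw [F_one_right, F_one_right, Finset.sum_range_succ _ (n + 1), mul_add]
    rw [this]
    have hp : HasDerivAt (fun z : ℝ => (a * z) ^ (n + 1) / ((n + 1).factorial : ℝ))
        ((n + 1 : ℕ) * (a * z) ^ n * a / ((n + 1).factorial : ℝ)) z := by
      have := ((((hasDerivAt_id z).const_mul a).pow (n + 1)).div_const ((n + 1).factorial : ℝ))
      simpa using this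
    refine (ih.add (hE.mul hp)).congr_deriv ?_
    have : (n.factorial : ℝ) ≠ 0 := by positivity
    rw [Nat.factorial_succ]
    push_cast
    field_simp
    ring

/-- Differentiating `(F_{n+1} + z F_n) / (1 + z)` gives `(F_{n+1}' + z F_n') / (1 + z) - (F_{n+1} -
F_n) / (1 + z)²`. The last term supplies the summand `w * meanMinor` with `w = 1 / (1 + z)`. -/
lemma hasDerivAt_F (m : ℕ) (a : ℝ) {z : ℝ} (hz : 1 + z ≠ 0) (n : ℕ) :
    HasDerivAt (F (n + 1) (m + 1) a)
      (-(Real.exp (-(a * z)) * (z ^ n / n.factorial) *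
        meanMinorTilted a (1 / (1 + z)) m n / (1 + z) ^ m)) z := by
  induction m generalizing n with
  | zero => simpa [meanMinorTilted] using hasDerivAt_F_zero n a z
  | succ m ih =>
    have hnhds : ∀ᶠ y in 𝓝 z, 1 + y ≠ 0 :=
      (continuousAt_const.add continuousAt_id).eventually_ne hz
    have heq : F (n + 1) (m + 1 + 1) a =ᶠ[𝓝 z] fun y =>
        (F (n + 1) (m + 1) a y + y * F n (m + 1) a y) / (1 + y) := by
      filter_upwards [hnhds] with y hy using F_succ_succ n m a hy
    have hden : HasDerivAt (fun y : ℝ => 1 + y) 1 z := by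
      simpa using (hasDerivAt_id z).const_add 1
    refine HasDerivAt.congr_of_eventuallyEq ?_ heq
    have hs := F_succ_sub m a hz n
    have h1 := ih n
    cases n with
    | zero =>
      have h0 : HasDerivAt (F 0 (m + 1) a) 0 z := by
        have : F 0 (m + 1) a = fun _ => 0 := funext fun y => F_zero_left _ _ _
        rw [this]; exact hasDerivAt_const _ _
      refine ((h1.add ((hasDerivAt_id z).mul h0)).div hden hz).congr_deriv ?_
      have e : F (0 + 1) (m + 1) a z = F 0 (m + 1) a z +
        Real.exp (-(a * z)) * (z ^ 0 / (0 : ℕ).factorial) * meanMinor a m 0 / (1 + z) ^ m := by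
        linarith
      simp only [Pi.add_apply, Pi.mul_apply, id, e, meanMinorTilted]
      field_simp
      simp [F_zero_left]
      ring
    | succ n =>
      have h0 := ih n
      refine ((h1.add ((hasDerivAt_id z).mul h0)).div hden hz).congr_deriv ?_
      have e : F (n + 1 + 1) (m + 1) a z = F (n + 1) (m + 1) a z +
        Real.exp (-(a * z)) * (z ^ (n + 1) / (n + 1).factorial) * meanMinor a m (n + 1) /
          (1 + z) ^ m := by
        linarith
      have : (n.factorial : ℝ) ≠ 0 := by positivity
      simp only [Pi.add_apply, Pi.mul_apply, id, e, meanMinorTilted, Nat.factorial_succ,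
        Nat.add_sub_cancel]
      push_cast
      field_simp
      ring

lemma tendsto_F (m n : ℕ) {a : ℝ} (ha : 0 < a) : Tendsto (F n (m + 1) a) atTop (𝓝 0) := by
  induction m generalizing n with
  | zero =>
    have : F n (0 + 1) a = fun z => ∑ k ∈ Finset.range n,
        ((a * z) ^ k * Real.exp (-(a * z))) / (k.factorial : ℝ) := by
      funext z
      rw [F_one_right, Finset.mul_sum]
      exact Finset.sum_congr rfl fun k _ => by ring
    rw [this, show (0 : ℝ) = ∑ k ∈ Finset.range n, 0 / (k.factorial : ℝ) by simp]
    refine tendsto_finsetSum _ fun k _ => Tendsto.div_const ?_ _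
    exact (Real.tendsto_pow_mul_exp_neg_atTop_nhds_zero k).comp (tendsto_id.const_mul_atTop ha)
  | succ m ih =>
    cases n with
    | zero =>
      have : F 0 (m + 1 + 1) a = fun _ => 0 := funext fun y => F_zero_left _ _ _
      rw [this]; exact tendsto_const_nhds
    | succ n =>
      -- For `z ≥ 0` the recursion is a weighted average, hence bounded by the sum of absolute
      -- values.
      have h : Tendsto (fun z => |F (n + 1) (m + 1) a z| + |F n (m + 1) a z|) atTop (𝓝 0) := by
        simpa using (ih (n + 1)).abs.add (ih n).abs
      refine squeeze_zero_norm' ?_ h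
      filter_upwards [eventually_ge_atTop 0] with z hz
      have hz1 : 0 < 1 + z := by linarith
      rw [F_succ_succ _ _ _ hz1.ne', Real.norm_eq_abs, abs_div, abs_of_pos hz1,
        div_le_iff₀ hz1]
      calc _ ≤ |F (n + 1) (m + 1) a z| + |z * F n (m + 1) a z| := abs_add_le _ _
        _ ≤ _ := by
          rw [abs_mul, abs_of_nonneg hz]
          nlinarith [abs_nonneg (F (n + 1) (m + 1) a z), abs_nonneg (F n (m + 1) a z)]

lemma F_at_zero (m n : ℕ) (a : ℝ) : F (n + 1) (m + 1) a 0 = 1 := by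
  induction m with
  | zero => simp [F_one_right, Finset.sum_range_succ']
  | succ m ih => rw [F_succ_succ _ _ _ (by simp), ih]; simp

lemma meanMinor_nonneg {a : ℝ} (ha : 0 ≤ a) (m k : ℕ) : 0 ≤ meanMinor a m k := by
  induction m generalizing k with
  | zero => simp only [meanMinor]; positivity
  | succ m ih =>
    have := ih k
    have := ih (k - 1)
    simp only [meanMinor]; positivity

lemma meanMinorTilted_nonneg {a w : ℝ} (ha : 0 ≤ a) (hw : 0 ≤ w) (m k : ℕ) :
    0 ≤ meanMinorTilted a w m k := by
  induction m generalizing k with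
  | zero => simp only [meanMinorTilted]; positivity
  | succ m ih =>
    have := ih k
    have := ih (k - 1)
    have := meanMinor_nonneg ha m k
    simp only [meanMinorTilted]; positivity

/-- `r ↦ -F(r²)` is an antiderivative of the radial density. -/
lemma hasDerivAt_F_sq (m n : ℕ) (a r : ℝ) :
    HasDerivAt (fun r => F (n + 1) (m + 1) a (r ^ 2))
      (-(2 / n.factorial * (r ^ (2 * n + 1) * (Real.exp (-(a * r ^ 2)) *
        (meanMinorTilted a (1 / (1 + r ^ 2)) m n / (1 + r ^ 2) ^ m))))) r := by
  have h1 : (1 : ℝ) + r ^ 2 ≠ 0 := by positivity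
  refine ((hasDerivAt_F m a h1 n).comp (h := fun r : ℝ => r ^ 2) r (hasDerivAt_pow 2 r)).congr_deriv ?_
  simp only [Nat.cast_ofNat, Nat.add_one_sub_one, pow_one]
  ring

/-! ### Rank-one updates of determinants and the interference matrix -/

/-- The **matrix determinant lemma** for an arbitrary, possibly singular, matrix. -/
lemma det_add_vecMulVec {ι : Type*} [Fintype ι] [DecidableEq ι] (A : Matrix ι ι ℂ) (u v : ι → ℂ) :
    (A + vecMulVec u v).det = A.det + v ⬝ᵥ (A.adjugate *ᵥ u) := by
  have key : ∀ A : Matrix ι ι ℂ, A.det ≠ 0 →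
      (A + vecMulVec u v).det = A.det + v ⬝ᵥ (A.adjugate *ᵥ u) := by
    intro A hA
    rw [vecMulVec_eq Unit, det_add_replicateCol_mul_replicateRow (Ne.isUnit hA), Matrix.mul_assoc,
      det_unique (n := Unit), Matrix.add_apply, Matrix.one_apply_eq, mul_add, mul_one, Matrix.inv_def,
      Ring.inverse_eq_inv', Matrix.smul_mul]
    congr 1
    rw [Matrix.mul_smul, Matrix.smul_apply, smul_eq_mul, mul_inv_cancel_left₀ hA,
      ← replicateCol_mulVec, replicateRow_mul_replicateCol_apply]
  -- `A + x I` is singular only at the finitely many roots of the characteristic polynomial of `-A`,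
  -- so the identity passes to the limit `x → 0`.
  have hne : ∀ᶠ x : ℂ in 𝓝[≠] 0, (A + x • (1 : Matrix ι ι ℂ)).det ≠ 0 := by
    have hfin : {x : ℂ | (A + x • (1 : Matrix ι ι ℂ)).det = 0}.Finite := by
      refine ((-A).charpoly.roots.toFinset.finite_toSet).subset fun x hx => ?_
      rw [Finset.mem_coe, Multiset.mem_toFinset,
        Polynomial.mem_roots (Matrix.charpoly_monic _).ne_zero, Polynomial.IsRoot,
        Matrix.eval_charpoly, sub_neg_eq_add, add_comm, Matrix.scalar_apply,
        ← Matrix.smul_one_eq_diagonal]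
      exact hx
    have hcl : ({x : ℂ | (A + x • (1 : Matrix ι ι ℂ)).det = 0} \ {0})ᶜ ∈ 𝓝 (0 : ℂ) :=
      ((hfin.subset Set.sdiff_subset).isClosed.isOpen_compl).mem_nhds (by simp)
    filter_upwards [mem_nhdsWithin_of_mem_nhds hcl, self_mem_nhdsWithin] with x hx hx0 h
    exact hx ⟨h, hx0⟩
  have hc : Continuous fun x : ℂ => A + x • (1 : Matrix ι ι ℂ) := by fun_prop
  have hl : Tendsto (fun x : ℂ => (A + x • (1 : Matrix ι ι ℂ) + vecMulVec u v).det) (𝓝[≠] 0)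
      (𝓝 (A + vecMulVec u v).det) := by
    have : Continuous fun x : ℂ => (A + x • (1 : Matrix ι ι ℂ) + vecMulVec u v).det :=
      (hc.add continuous_const).matrix_det
    simpa using (this.tendsto 0).mono_left nhdsWithin_le_nhds
  have hr : Tendsto (fun x : ℂ => (A + x • (1 : Matrix ι ι ℂ)).det +
      v ⬝ᵥ ((A + x • (1 : Matrix ι ι ℂ)).adjugate *ᵥ u)) (𝓝[≠] 0)
      (𝓝 (A.det + v ⬝ᵥ (A.adjugate *ᵥ u))) := by
    have : Continuous fun x : ℂ => (A + x • (1 : Matrix ι ι ℂ)).det +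
        v ⬝ᵥ ((A + x • (1 : Matrix ι ι ℂ)).adjugate *ᵥ u) :=
      hc.matrix_det.add
        (continuous_const.dotProduct (hc.matrix_adjugate.matrix_mulVec continuous_const))
    simpa using (this.tendsto 0).mono_left nhdsWithin_le_nhds
  refine tendsto_nhds_unique (hl.congr' ?_) hr
  filter_upwards [hne] with x hx using key _ hx

/-- The noise-plus-interference matrix `a I + ∑ⱼ cⱼ cⱼ†`. -/
noncomputable def interferenceMatrix {n m : ℕ} (a : ℝ) (C : Fin m → Fin n → ℂ) :
    Matrix (Fin n) (Fin n) ℂ :=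
  (a : ℂ) • 1 + ∑ j, vecMulVec (C j) (star (C j))

lemma interferenceMatrix_succ {n m : ℕ} (a : ℝ) (C : Fin (m + 1) → Fin n → ℂ) :
    interferenceMatrix a C =
      interferenceMatrix a (fun j => C j.succ) + vecMulVec (C 0) (star (C 0)) := by
  simp only [interferenceMatrix, Fin.sum_univ_succ]
  abel

lemma posDef_interferenceMatrix {n m : ℕ} {a : ℝ} (ha : 0 < a) (C : Fin m → Fin n → ℂ) :
    (interferenceMatrix a C).PosDef := by
  have h1 : ((a : ℂ) • (1 : Matrix (Fin n) (Fin n) ℂ)).PosDef :=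
    Matrix.PosDef.one.smul (by exact_mod_cast ha)
  exact h1.add_posSemidef
    (Matrix.posSemidef_sum _ fun j _ => Matrix.posSemidef_vecMulVec_self_star (C j))

/-- One column enters a minor only through products `c_p * star c_q`, so independence reduces its
mean to second moments. -/
lemma det_interferenceMatrix_submatrix_succ {n m k : ℕ} (a : ℝ) (C : Fin (m + 1) → Fin n → ℂ)
    (e f : Fin (k + 1) → Fin n) :
    ((interferenceMatrix a C).submatrix e f).det =
      ((interferenceMatrix a fun j => C j.succ).submatrix e f).det +
        ∑ i, ∑ j, (C 0 (e j) * star (C 0 (f i))) * ((-1) ^ (j + i : ℕ) *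
          ((interferenceMatrix a fun j => C j.succ).submatrix (e ∘ j.succAbove)
            (f ∘ i.succAbove)).det) := by
  have h : (interferenceMatrix a C).submatrix e f =
      (interferenceMatrix a fun j => C j.succ).submatrix e f +
        vecMulVec (fun i => C 0 (e i)) (fun i => star (C 0 (f i))) := by
    rw [interferenceMatrix_succ]; ext i j; simp [vecMulVec_apply]
  rw [h, det_add_vecMulVec]
  congr 1
  simp only [dotProduct, mulVec, Finset.mul_sum]
  refine Finset.sum_congr rfl fun i _ => Finset.sum_congr rfl fun j _ => ?_
  rw [adjugate_fin_succ_eq_det_submatrix, Matrix.submatrix_submatrix]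
  ring

/-! ### Mean principal minors from second moments -/

section SecondMoments

variable {n : ℕ} (ν : Measure (Fin n → ℂ)) [IsProbabilityMeasure ν]

lemma measurePreserving_pi_uncons (m : ℕ) :
    MeasurePreserving (fun C : Fin (m + 1) → Fin n → ℂ => (C 0, fun j : Fin m => C j.succ))
      (Measure.pi fun _ => ν) (ν.prod (Measure.pi fun _ => ν)) :=
  measurePreserving_piFinSuccAbove (fun _ : Fin (m + 1) => ν) 0

/-- The row and column selections `e`, `f` are distinct because expanding even a principal minor
produces non-principal ones. -/
lemma integrable_minor (hint : ∀ i j, Integrable (fun h : Fin n → ℂ => h i * star (h j)) ν)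
    (a : ℝ) (m : ℕ) {k : ℕ} (e f : Fin k → Fin n) :
    Integrable (fun C : Fin m → Fin n → ℂ => ((interferenceMatrix a C).submatrix e f).det)
      (Measure.pi fun _ => ν) := by
  induction m generalizing k with
  | zero =>
    have : (fun C : Fin 0 → Fin n → ℂ => ((interferenceMatrix a C).submatrix e f).det) =
        fun _ => (((a : ℂ) • (1 : Matrix (Fin n) (Fin n) ℂ)).submatrix e f).det := by
      funext C; simp [interferenceMatrix]
    rw [this]; exact integrable_const _
  | succ m ih =>
    cases k with
    | zero => simp only [det_fin_zero]; exact integrable_const _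
    | succ k =>
      have key : Integrable (fun p : (Fin n → ℂ) × (Fin m → Fin n → ℂ) =>
          ((interferenceMatrix a p.2).submatrix e f).det +
          ∑ i : Fin (k + 1), ∑ j : Fin (k + 1),
            (p.1 (e j) * star (p.1 (f i))) * ((-1) ^ (j + i : ℕ) *
            ((interferenceMatrix a p.2).submatrix (e ∘ j.succAbove) (f ∘ i.succAbove)).det))
          (ν.prod (Measure.pi fun _ => ν)) := by
        refine Integrable.add ((ih e f).comp_snd ν) ?_
        refine integrable_finsetSum _ fun i _ => integrable_finsetSum _ fun j _ => ?_
        exact (hint (e j) (f i)).mul_prod ((ih _ _).const_mul _)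
      refine ((measurePreserving_pi_uncons ν m).integrable_comp_of_integrable key).congr ?_
      exact Eventually.of_forall fun C => (det_interferenceMatrix_submatrix_succ a C e f).symm

variable {ν}

/-- Column `0` is independent of the others. Uncorrelated coordinates and injectivity of `e` leave
only the terms `i = j`, where the sign is `+1`. -/
lemma integral_minor_succ {v : Fin n → ℝ}
    (hint : ∀ i j, Integrable (fun h : Fin n → ℂ => h i * star (h j)) ν)
    (hmom : ∀ i j, ∫ h, h i * star (h j) ∂ν = if i = j then (v i : ℂ) else 0)
    (a : ℝ) (m : ℕ) {k : ℕ} (e : Fin (k + 1) → Fin n) (he : Function.Injective e) :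
    ∫ C : Fin (m + 1) → Fin n → ℂ, ((interferenceMatrix a C).submatrix e e).det
        ∂(Measure.pi fun _ => ν) =
      ∫ C : Fin m → Fin n → ℂ, ((interferenceMatrix a C).submatrix e e).det
        ∂(Measure.pi fun _ => ν) +
      ∑ i, (v (e i) : ℂ) * ∫ C : Fin m → Fin n → ℂ,
        ((interferenceMatrix a C).submatrix (e ∘ i.succAbove) (e ∘ i.succAbove)).det
          ∂(Measure.pi fun _ => ν) := by
  have hterm : ∀ i j : Fin (k + 1), Integrable (fun p : (Fin n → ℂ) × (Fin m → Fin n → ℂ) =>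
      (p.1 (e j) * star (p.1 (e i))) * ((-1) ^ (j + i : ℕ) *
        ((interferenceMatrix a p.2).submatrix (e ∘ j.succAbove) (e ∘ i.succAbove)).det))
      (ν.prod (Measure.pi fun _ => ν)) := fun i j =>
    (hint (e j) (e i)).mul_prod ((integrable_minor ν hint a m _ _).const_mul _)
  have hsum := integrable_finsetSum Finset.univ fun i _ =>
    integrable_finsetSum Finset.univ fun j _ => hterm i j
  have hfirst := (integrable_minor ν hint a m e e).comp_snd ν
  have h1 : ∫ C : Fin (m + 1) → Fin n → ℂ, ((interferenceMatrix a C).submatrix e e).det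
        ∂(Measure.pi fun _ => ν) = ∫ p : (Fin n → ℂ) × (Fin m → Fin n → ℂ),
          (((interferenceMatrix a p.2).submatrix e e).det +
          ∑ i : Fin (k + 1), ∑ j : Fin (k + 1),
            (p.1 (e j) * star (p.1 (e i))) * ((-1) ^ (j + i : ℕ) *
            ((interferenceMatrix a p.2).submatrix (e ∘ j.succAbove) (e ∘ i.succAbove)).det))
          ∂(ν.prod (Measure.pi fun _ => ν)) := by
    rw [← (measurePreserving_pi_uncons ν m).map_eq, integral_map
      (measurePreserving_pi_uncons ν m).measurable.aemeasurable]
    · exact integral_congr_ae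
        (Eventually.of_forall fun C => det_interferenceMatrix_submatrix_succ a C e e)
    · rw [(measurePreserving_pi_uncons ν m).map_eq]
      exact (hfirst.add hsum).aestronglyMeasurable
  rw [h1, integral_add hfirst hsum]
  congr 1
  · rw [integral_fun_snd (fun C : Fin m → Fin n → ℂ =>
      ((interferenceMatrix a C).submatrix e e).det)]
    simp
  · rw [integral_finsetSum _ fun i _ => integrable_finsetSum Finset.univ fun j _ => hterm i j]
    refine Finset.sum_congr rfl fun i _ => ?_
    rw [integral_finsetSum _ fun j _ => hterm i j, Finset.sum_eq_single i]
    · rw [integral_prod_mul (fun h : Fin n → ℂ => h (e i) * star (h (e i)))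
        (fun C : Fin m → Fin n → ℂ => (-1) ^ (i + i : ℕ) *
        ((interferenceMatrix a C).submatrix (e ∘ i.succAbove) (e ∘ i.succAbove)).det), hmom]
      simp [← two_mul, pow_mul]
    · intro j _ hj
      rw [integral_prod_mul (fun h : Fin n → ℂ => h (e j) * star (h (e i)))
        (fun C : Fin m → Fin n → ℂ => (-1) ^ (j + i : ℕ) *
        ((interferenceMatrix a C).submatrix (e ∘ j.succAbove) (e ∘ i.succAbove)).det), hmom,
        if_neg (he.ne hj), zero_mul]
    · simp

lemma integral_minor_zero (a : ℝ) {k : ℕ} (e : Fin k → Fin n) (he : Function.Injective e) :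
    ∫ C : Fin 0 → Fin n → ℂ, ((interferenceMatrix a C).submatrix e e).det
        ∂(Measure.pi fun _ => ν) = (a : ℂ) ^ k := by
  have : (fun C : Fin 0 → Fin n → ℂ => ((interferenceMatrix a C).submatrix e e).det) =
      fun _ => (a : ℂ) ^ k := by
    funext C
    simp [interferenceMatrix, Matrix.submatrix_smul, Matrix.submatrix_one e he]
  rw [this]; simp

lemma integral_minor_of_unit {v : Fin n → ℝ}
    (hint : ∀ i j, Integrable (fun h : Fin n → ℂ => h i * star (h j)) ν)
    (hmom : ∀ i j, ∫ h, h i * star (h j) ∂ν = if i = j then (v i : ℂ) else 0)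
    (a : ℝ) (m : ℕ) {k : ℕ} (e : Fin k → Fin n) (he : Function.Injective e)
    (hv : ∀ i, v (e i) = 1) :
    ∫ C : Fin m → Fin n → ℂ, ((interferenceMatrix a C).submatrix e e).det
        ∂(Measure.pi fun _ => ν) = (meanMinor a m k : ℂ) := by
  induction m generalizing k with
  | zero => rw [integral_minor_zero a e he]; simp [meanMinor]
  | succ m ih =>
    cases k with
    | zero =>
      have h0 := ih e he hv
      simp only [det_fin_zero] at h0 ⊢
      simpa [meanMinor] using h0
    | succ k =>
      rw [integral_minor_succ hint hmom a m e he, ih e he hv]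
      have : ∀ i : Fin (k + 1), _ := fun i => ih (e ∘ i.succAbove)
        (he.comp Fin.succAbove_right_injective) fun j => hv _
      simp [this, hv, meanMinor]

/-- Deleting the tilted index leaves a unit-variance minor with weight `w`; deleting any other index
leaves a smaller minor with the tilted index still first. -/
lemma integral_minor_of_tilted {v : Fin n → ℝ}
    (hint : ∀ i j, Integrable (fun h : Fin n → ℂ => h i * star (h j)) ν)
    (hmom : ∀ i j, ∫ h, h i * star (h j) ∂ν = if i = j then (v i : ℂ) else 0)
    (a : ℝ) {w : ℝ} (m : ℕ) {k : ℕ} (e : Fin (k + 1) → Fin n) (he : Function.Injective e)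
    (hw : v (e 0) = w) (hv : ∀ i : Fin k, v (e i.succ) = 1) :
    ∫ C : Fin m → Fin n → ℂ, ((interferenceMatrix a C).submatrix e e).det
        ∂(Measure.pi fun _ => ν) = (meanMinorTilted a w m k : ℂ) := by
  induction m generalizing k with
  | zero => rw [integral_minor_zero a e he]; simp [meanMinorTilted]
  | succ m ih =>
    rw [integral_minor_succ hint hmom a m e he, ih e he hw hv, Fin.sum_univ_succ, hw,
      integral_minor_of_unit hint hmom a m (e ∘ Fin.succAbove 0)
        (he.comp Fin.succAbove_right_injective) (fun j => by simpa using hv j)]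
    cases k with
    | zero => simp [meanMinorTilted]
    | succ k =>
      have : ∀ i : Fin (k + 1), _ := fun i => ih (e ∘ i.succ.succAbove)
        (he.comp Fin.succAbove_right_injective) (by simpa using hw)
        (fun j => by simpa [Fin.succ_succAbove_succ] using hv (i.succAbove j))
      simp [this, hv, meanMinorTilted, add_assoc]

end SecondMoments

/-! ### Densities of product measures -/

section ProductDensity

variable {α : Type*} [MeasurableSpace α]

lemma lintegral_fin_prod_pi {n : ℕ} (μ : Fin n → Measure α) [∀ i, SigmaFinite (μ i)]
    {f : Fin n → α → ℝ≥0∞} (hf : ∀ i, Measurable (f i)) :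
    ∫⁻ x, ∏ i, f i (x i) ∂(Measure.pi μ) = ∏ i, ∫⁻ x, f i x ∂(μ i) := by
  induction n with
  | zero => simp
  | succ n ih =>
    have hmp := measurePreserving_piFinSuccAbove μ 0
    have hg : Measurable fun p : α × (Fin n → α) => f 0 p.1 * ∏ i : Fin n, f i.succ (p.2 i) :=
      ((hf 0).comp measurable_fst).mul (Finset.measurable_prod _ fun i _ =>
        (hf i.succ).comp ((measurable_pi_apply i).comp measurable_snd))
    have h1 : ∫⁻ x, ∏ i, f i (x i) ∂(Measure.pi μ) =
        ∫⁻ p : α × (Fin n → α), f 0 p.1 * ∏ i : Fin n, f i.succ (p.2 i)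
          ∂((μ 0).prod (Measure.pi fun j : Fin n => μ j.succ)) := by
      have := hmp.lintegral_comp hg
      simp only [Fin.zero_succAbove] at this
      rw [← this]
      refine lintegral_congr fun x => ?_
      rw [Fin.prod_univ_succ]
      rfl
    rw [h1, Fin.prod_univ_succ,
      lintegral_prod_mul (f := f 0) (g := fun y : Fin n → α => ∏ i : Fin n, f i.succ (y i))
        (hf 0).aemeasurable (Finset.measurable_prod _ fun i _ =>
        (hf i.succ).comp (measurable_pi_apply i)).aemeasurable,
      ih (fun j => μ j.succ) fun i => hf i.succ]

lemma pi_withDensity {n : ℕ} (μ : Fin n → Measure α) [∀ i, SigmaFinite (μ i)]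
    {f : Fin n → α → ℝ≥0∞} (hf : ∀ i, Measurable (f i))
    [∀ i, SigmaFinite ((μ i).withDensity (f i))] :
    Measure.pi (fun i => (μ i).withDensity (f i)) =
      (Measure.pi μ).withDensity fun x => ∏ i, f i (x i) := by
  refine Measure.pi_eq fun s hs => ?_
  rw [withDensity_apply _ (MeasurableSet.univ_pi hs), ← lintegral_indicator (MeasurableSet.univ_pi hs)]
  have : (fun x : Fin n → α => (Set.univ.pi s).indicator (fun x => ∏ i, f i (x i)) x) =
      fun x => ∏ i, (s i).indicator (f i) (x i) := by
    funext x
    by_cases hx : x ∈ Set.univ.pi s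
    · rw [Set.indicator_of_mem hx]
      exact Finset.prod_congr rfl fun i _ => (Set.indicator_of_mem (hx i trivial) _).symm
    · rw [Set.indicator_of_notMem hx]
      simp only [Set.mem_univ_pi, not_forall] at hx
      obtain ⟨i, hi⟩ := hx
      exact (Finset.prod_eq_zero (Finset.mem_univ i) (Set.indicator_of_notMem hi _)).symm
  rw [this, lintegral_fin_prod_pi μ fun i => (hf i).indicator (hs i)]
  refine Finset.prod_congr rfl fun i _ => ?_
  rw [withDensity_apply _ (hs i), lintegral_indicator (hs i)]

end ProductDensity

/-! ### Circular Gaussian laws and their moments -/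

/-- The circularly symmetric complex Gaussian law of variance `1 / b`. -/
noncomputable def circularGaussian (b : ℝ) : Measure ℂ :=
  volume.withDensity fun z => ENNReal.ofReal (b / Real.pi * Real.exp (-b * ‖z‖ ^ 2))

lemma measurable_circularGaussian_density (b : ℝ) :
    Measurable fun z : ℂ => ENNReal.ofReal (b / Real.pi * Real.exp (-b * ‖z‖ ^ 2)) := by
  fun_prop

lemma integral_exp_neg_mul_norm_sq {b : ℝ} (hb : 0 < b) :
    ∫ z : ℂ, Real.exp (-b * ‖z‖ ^ 2) = Real.pi / b := by
  have h := Complex.integral_exp_neg_mul_rpow (p := 2) one_le_two hb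
  simp only [Real.rpow_two] at h
  rw [h, show (-2 : ℝ) / 2 = -1 by norm_num, show (2 : ℝ) / 2 + 1 = 2 by norm_num,
    Real.Gamma_two, Real.rpow_neg_one]
  ring

lemma integral_norm_sq_mul_exp_neg_mul_norm_sq {b : ℝ} (hb : 0 < b) :
    ∫ z : ℂ, ‖z‖ ^ 2 * Real.exp (-b * ‖z‖ ^ 2) = Real.pi / b ^ 2 := by
  have h := Complex.integral_rpow_mul_exp_neg_mul_rpow (p := 2) (q := 2) one_le_two
    (by norm_num) hb
  simp only [Real.rpow_two] at h
  rw [h, show (-(2 + 2) : ℝ) / 2 = -2 by norm_num, show ((2 : ℝ) + 2) / 2 = 2 by norm_num,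
    Real.Gamma_two, Real.rpow_neg hb.le, Real.rpow_two]
  ring

lemma isProbabilityMeasure_circularGaussian {b : ℝ} (hb : 0 < b) :
    IsProbabilityMeasure (circularGaussian b) := by
  constructor
  have hi := integral_exp_neg_mul_norm_sq hb
  have hpi := Real.pi_pos
  -- A non-integrable function has Bochner integral `0`, so a nonzero value proves integrability.
  have hint : Integrable fun z : ℂ => Real.exp (-b * ‖z‖ ^ 2) :=
    Integrable.of_integral_ne_zero (by rw [hi]; positivity)
  rw [circularGaussian, withDensity_apply _ MeasurableSet.univ, Measure.restrict_univ,
    ← ofReal_integral_eq_lintegral_ofReal (hint.const_mul _)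
      (Eventually.of_forall fun z => by positivity), integral_const_mul, hi]
  rw [div_mul_div_cancel₀ hpi.ne', div_self hb.ne', ENNReal.ofReal_one]

lemma integral_circularGaussian {b : ℝ} (hb : 0 < b) (f : ℂ → ℝ) :
    ∫ z, f z ∂(circularGaussian b) =
      b / Real.pi * ∫ z : ℂ, f z * Real.exp (-b * ‖z‖ ^ 2) := by
  have hpi := Real.pi_pos
  rw [circularGaussian, integral_withDensity_eq_integral_toReal_smul
    (measurable_circularGaussian_density b) (by simp), ← integral_const_mul]
  refine integral_congr_ae (Eventually.of_forall fun z => ?_)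
  simp only [smul_eq_mul]
  rw [ENNReal.toReal_ofReal (by positivity)]
  ring

lemma integral_norm_sq_circularGaussian {b : ℝ} (hb : 0 < b) :
    ∫ z, ‖z‖ ^ 2 ∂(circularGaussian b) = 1 / b := by
  have hpi := Real.pi_pos
  rw [integral_circularGaussian hb, integral_norm_sq_mul_exp_neg_mul_norm_sq hb]
  field_simp

lemma integrable_norm_sq_circularGaussian {b : ℝ} (hb : 0 < b) :
    Integrable (fun z : ℂ => ‖z‖ ^ 2) (circularGaussian b) :=
  Integrable.of_integral_ne_zero (by
    rw [integral_norm_sq_circularGaussian hb]; positivity)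

lemma measurePreserving_neg_circularGaussian (b : ℝ) :
    MeasurePreserving (fun z : ℂ => -z) (circularGaussian b) (circularGaussian b) := by
  refine ⟨measurable_neg, ?_⟩
  refine Measure.ext_of_lintegral _ fun f hf => ?_
  rw [lintegral_map hf measurable_neg, circularGaussian,
    lintegral_withDensity_eq_lintegral_mul _ (measurable_circularGaussian_density b)
      (g := fun z => f (-z)) (hf.comp measurable_neg),
    lintegral_withDensity_eq_lintegral_mul _ (measurable_circularGaussian_density b) hf,
    ← (Measure.measurePreserving_neg (volume : Measure ℂ)).lintegral_comp
      ((measurable_circularGaussian_density b).mul hf)]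
  simp

lemma complexGaussian_eq : complexGaussian = circularGaussian 1 := by
  have hv : (1 / 2 : NNReal) ≠ 0 := by norm_num
  have hmp := Complex.volume_preserving_equiv_real_prod.symm
  have hfun : (fun p : ℝ × ℝ => (p.1 : ℂ) + (p.2 : ℂ) * Complex.I) =
      Complex.measurableEquivRealProd.symm := by
    funext p
    simp only [Complex.measurableEquivRealProd_symm_apply]
    apply Complex.ext <;> simp
  rw [complexGaussian, hfun, gaussianReal_of_var_ne_zero 0 hv,
    prod_withDensity (measurable_gaussianPDF _ _) (measurable_gaussianPDF _ _)]
  refine Measure.ext_of_lintegral _ fun f hf => ?_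
  have hm : Measurable fun z : ℝ × ℝ => gaussianPDF 0 (1 / 2) z.1 * gaussianPDF 0 (1 / 2) z.2 :=
    ((measurable_gaussianPDF _ _).comp measurable_fst).mul
      ((measurable_gaussianPDF _ _).comp measurable_snd)
  rw [lintegral_map hf (MeasurableEquiv.measurable _),
    lintegral_withDensity_eq_lintegral_mul _ hm
      (g := fun p => f (Complex.measurableEquivRealProd.symm p))
      (hf.comp (MeasurableEquiv.measurable _)),
    circularGaussian, lintegral_withDensity_eq_lintegral_mul _
      (measurable_circularGaussian_density 1) hf,
    ← hmp.lintegral_comp ((measurable_circularGaussian_density 1).mul hf)]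
  refine lintegral_congr fun p => ?_
  simp only [Pi.mul_apply]
  congr 1
  rw [gaussianPDF, gaussianPDF, ← ENNReal.ofReal_mul (gaussianPDFReal_nonneg _ _ _)]
  congr 1
  have hn : ‖Complex.measurableEquivRealProd.symm p‖ ^ 2 = p.1 ^ 2 + p.2 ^ 2 := by
    rw [Complex.measurableEquivRealProd_symm_apply, ← Complex.normSq_eq_norm_sq,
      Complex.normSq_mk]
    ring
  rw [hn, gaussianPDFReal, gaussianPDFReal, mul_mul_mul_comm, ← Real.exp_add, ← mul_inv,
    Real.mul_self_sqrt (by positivity)]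
  push_cast
  congr 1
  · rw [one_div, mul_right_comm]; norm_num
  · congr 1; ring

section Moments

variable {n : ℕ} {b : Fin n → ℝ}

lemma integrable_mul_star_pi (hb : ∀ i, 0 < b i) (i j : Fin n) :
    Integrable (fun h : Fin n → ℂ => h i * star (h j))
      (Measure.pi fun i => circularGaussian (b i)) := by
  have := fun i => isProbabilityMeasure_circularGaussian (hb i)
  have hi : ∀ i, Integrable (fun h : Fin n → ℂ => ‖h i‖ ^ 2)
      (Measure.pi fun i => circularGaussian (b i)) := fun i =>
    (measurePreserving_eval (fun i => circularGaussian (b i)) i).integrable_comp_of_integrable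
      (integrable_norm_sq_circularGaussian (hb i))
  refine ((hi i).add (hi j)).mono' ?_ (Eventually.of_forall fun h => ?_)
  · exact (Continuous.aestronglyMeasurable (by fun_prop))
  · simp only [norm_mul, norm_star, Pi.add_apply]
    nlinarith [sq_nonneg (‖h i‖ - ‖h j‖), sq_nonneg ‖h i‖, sq_nonneg ‖h j‖]

lemma integral_mul_star_pi (hb : ∀ i, 0 < b i) (i j : Fin n) :
    ∫ h, h i * star (h j) ∂(Measure.pi fun i => circularGaussian (b i)) =
      if i = j then ((1 / b i : ℝ) : ℂ) else 0 := by
  have := fun i => isProbabilityMeasure_circularGaussian (hb i)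
  split_ifs with hij
  · subst hij
    have h1 : ∀ h : Fin n → ℂ, h i * star (h i) = ((‖h i‖ ^ 2 : ℝ) : ℂ) := fun h => by
      rw [Complex.star_def, Complex.mul_conj, Complex.normSq_eq_norm_sq]
    simp_rw [h1]
    rw [integral_complex_ofReal, ← integral_norm_sq_circularGaussian (hb i),
      ← (measurePreserving_eval (fun i => circularGaussian (b i)) i).map_eq,
      integral_map (measurable_pi_apply i).aemeasurable
        (Continuous.aestronglyMeasurable (by fun_prop))]
  -- Flipping the sign of coordinate `i` preserves the law and negates the integrand.
  · have hmp : MeasurePreserving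
        (fun (h : Fin n → ℂ) (k : Fin n) => (if k = i then fun z : ℂ => -z else id) (h k))
        (Measure.pi fun i => circularGaussian (b i)) (Measure.pi fun i => circularGaussian (b i)) := by
      refine measurePreserving_pi _ _ (f := fun k => if k = i then fun z : ℂ => -z else id)
        fun k => ?_
      split_ifs
      · exact measurePreserving_neg_circularGaussian _
      · exact MeasurePreserving.id _
    have h2 : ∫ h, h i * star (h j) ∂(Measure.pi fun i => circularGaussian (b i)) =
        -∫ h, h i * star (h j) ∂(Measure.pi fun i => circularGaussian (b i)) := by
      conv_lhs => rw [← hmp.map_eq]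
      rw [integral_map hmp.measurable.aemeasurable
        (Continuous.aestronglyMeasurable (by fun_prop)), ← integral_neg]
      refine integral_congr_ae (Eventually.of_forall fun h => ?_)
      simp [Ne.symm hij]
    exact self_eq_neg.mp h2

end Moments

instance : IsProbabilityMeasure complexGaussian := by
  rw [complexGaussian_eq]; exact isProbabilityMeasure_circularGaussian one_pos

/-! ### Gaussian vectors: unitary invariance and whitening -/

/-- The law of a vector of `n` i.i.d. `CN(0,1)` coordinates. -/
noncomputable def gaussianVector (n : ℕ) : Measure (Fin n → ℂ) :=
  Measure.pi fun _ => complexGaussian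

instance (n : ℕ) : IsProbabilityMeasure (gaussianVector n) := by
  unfold gaussianVector; infer_instance

/-- The squared Euclidean norm of a complex vector. -/
noncomputable def normSqSum {n : ℕ} (h : Fin n → ℂ) : ℝ := ∑ i, ‖h i‖ ^ 2

lemma normSqSum_nonneg {n : ℕ} (h : Fin n → ℂ) : 0 ≤ normSqSum h :=
  Finset.sum_nonneg fun _ _ => sq_nonneg _

lemma continuous_normSqSum {n : ℕ} : Continuous (normSqSum : (Fin n → ℂ) → ℝ) := by
  unfold normSqSum; fun_prop

lemma star_dotProduct_self {n : ℕ} (h : Fin n → ℂ) : star h ⬝ᵥ h = (normSqSum h : ℂ) := by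
  simp only [dotProduct, Pi.star_apply, normSqSum, Complex.ofReal_sum]
  refine Finset.sum_congr rfl fun i _ => ?_
  rw [Complex.star_def, mul_comm, Complex.mul_conj, Complex.normSq_eq_norm_sq]

lemma star_mulVec_dotProduct {n : ℕ} (B : Matrix (Fin n) (Fin n) ℂ) (g h : Fin n → ℂ) :
    star (B *ᵥ g) ⬝ᵥ h = star g ⬝ᵥ (Bᴴ *ᵥ h) := by
  rw [star_mulVec, dotProduct_mulVec]

lemma normSqSum_mulVec {n : ℕ} (B : Matrix (Fin n) (Fin n) ℂ) (g : Fin n → ℂ) :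
    normSqSum (B *ᵥ g) = (star g ⬝ᵥ ((Bᴴ * B) *ᵥ g)).re := by
  rw [← mulVec_mulVec, ← star_mulVec_dotProduct, star_dotProduct_self, Complex.ofReal_re]

lemma normSqSum_mulVec_of_unitary {n : ℕ} {U : Matrix (Fin n) (Fin n) ℂ} (hU : Uᴴ * U = 1)
    (g : Fin n → ℂ) : normSqSum (U *ᵥ g) = normSqSum g := by
  rw [normSqSum_mulVec, hU, one_mulVec, star_dotProduct_self, Complex.ofReal_re]

/-- The density of `gaussianVector n`. -/
noncomputable def gaussianDensity (n : ℕ) (h : Fin n → ℂ) : ℝ :=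
  Real.pi⁻¹ ^ n * Real.exp (-normSqSum h)

lemma measurable_ofReal_gaussianDensity (n : ℕ) :
    Measurable fun h : Fin n → ℂ => ENNReal.ofReal (gaussianDensity n h) := by
  unfold gaussianDensity
  have := (continuous_normSqSum (n := n)).measurable
  fun_prop

lemma gaussianVector_eq (n : ℕ) :
    gaussianVector n = volume.withDensity fun h => ENNReal.ofReal (gaussianDensity n h) := by
  have hp := isProbabilityMeasure_circularGaussian one_pos
  unfold gaussianVector
  rw [complexGaussian_eq]
  have : ∀ _ : Fin n, SigmaFinite ((volume : Measure ℂ).withDensity fun z =>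
      ENNReal.ofReal (1 / Real.pi * Real.exp (-1 * ‖z‖ ^ 2))) := fun _ => by
    change SigmaFinite (circularGaussian 1); infer_instance
  have h := pi_withDensity (fun _ : Fin n => (volume : Measure ℂ))
    (f := fun _ z => ENNReal.ofReal (1 / Real.pi * Real.exp (-1 * ‖z‖ ^ 2)))
    fun _ => measurable_circularGaussian_density 1
  rw [volume_pi]
  refine h.trans ?_
  congr 1
  funext x
  rw [← ENNReal.ofReal_prod_of_nonneg fun i _ => by positivity, Finset.prod_mul_distrib,
    ← Real.exp_sum, gaussianDensity, normSqSum]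
  simp

lemma lintegral_gaussianVector {n : ℕ} {f : (Fin n → ℂ) → ℝ≥0∞} (hf : Measurable f) :
    ∫⁻ h, f h ∂(gaussianVector n) = ∫⁻ h, ENNReal.ofReal (gaussianDensity n h) * f h := by
  rw [gaussianVector_eq, lintegral_withDensity_eq_lintegral_mul _
    (measurable_ofReal_gaussianDensity n) hf]
  rfl

/-- Change of variables under an invertible complex-linear map. -/
lemma lintegral_mulVec {n : ℕ} {B : Matrix (Fin n) (Fin n) ℂ} (hB : B.det ≠ 0)
    {f : (Fin n → ℂ) → ℝ≥0∞} (hf : Measurable f) :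
    ∫⁻ h, f h = ENNReal.ofReal (‖B.det‖ ^ 2) * ∫⁻ g, f (B *ᵥ g) := by
  -- The real determinant of a complex-linear map is the squared modulus of its complex determinant.
  have hdet : LinearMap.det ((Matrix.toLin' B).restrictScalars ℝ) = ‖B.det‖ ^ 2 := by
    rw [LinearMap.det_restrictScalars, LinearMap.det_toLin', Algebra.norm_complex_apply,
      Complex.normSq_eq_norm_sq]
  have hpos : 0 < ‖B.det‖ ^ 2 := by positivity
  have hmap := Measure.map_linearMap_addHaar_eq_smul_addHaar (volume : Measure (Fin n → ℂ))
    (f := (Matrix.toLin' B).restrictScalars ℝ) (by rw [hdet]; exact hpos.ne')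
  have hmeas : Measurable fun g : Fin n → ℂ => B *ᵥ g :=
    (Continuous.matrix_mulVec continuous_const continuous_id).measurable
  have hmap' : Measure.map (fun g : Fin n → ℂ => B *ᵥ g) volume =
      ENNReal.ofReal (‖B.det‖ ^ 2)⁻¹ • volume := by
    rw [hdet, abs_of_pos (by positivity)] at hmap
    exact hmap
  rw [← lintegral_map hf hmeas, hmap', lintegral_smul_measure, smul_eq_mul, ← mul_assoc,
    ← ENNReal.ofReal_mul hpos.le, mul_inv_cancel₀ hpos.ne', ENNReal.ofReal_one, one_mul]

lemma measurePreserving_mulVec_gaussianVector {n : ℕ} {U : Matrix (Fin n) (Fin n) ℂ}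
    (hU : Uᴴ * U = 1) :
    MeasurePreserving (fun g => U *ᵥ g) (gaussianVector n) (gaussianVector n) := by
  have hmeas : Measurable fun g : Fin n → ℂ => U *ᵥ g :=
    (Continuous.matrix_mulVec continuous_const continuous_id).measurable
  refine ⟨hmeas, Measure.ext_of_lintegral _ fun f hf => ?_⟩
  have hdet : ‖U.det‖ ^ 2 = 1 := by
    have := congrArg Matrix.det hU
    rw [det_mul, det_conjTranspose, det_one, Complex.star_def, mul_comm, Complex.mul_conj,
      Complex.normSq_eq_norm_sq] at this
    exact_mod_cast this
  have hne : U.det ≠ 0 := fun h => by simp [h] at hdet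
  rw [lintegral_map hf hmeas, lintegral_gaussianVector (f := fun g => f (U *ᵥ g)) (hf.comp hmeas),
    lintegral_gaussianVector hf,
    lintegral_mulVec (f := fun h => ENNReal.ofReal (gaussianDensity n h) * f h) hne
      ((measurable_ofReal_gaussianDensity n).mul hf), hdet, ENNReal.ofReal_one, one_mul]
  simp only [gaussianDensity, normSqSum_mulVec_of_unitary hU]

/-- Whitening: the substitution `h = M^{1/2} g` in a Gaussian integral of a function of the
quadratic form `h† M⁻¹ h`. -/
lemma lintegral_gaussianVector_quadratic_form {n : ℕ} {M : Matrix (Fin n) (Fin n) ℂ}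
    (hM : M.PosDef) {f : ℝ → ℝ≥0∞} (hf : Measurable f) :
    ∫⁻ h, f (star h ⬝ᵥ (M⁻¹ *ᵥ h)).re ∂(gaussianVector n) =
      ∫⁻ g, f (normSqSum g) * ENNReal.ofReal
        (Real.pi⁻¹ ^ n * (M.det.re * Real.exp (-(star g ⬝ᵥ (M *ᵥ g)).re))) := by
  -- The positive square root is Hermitian, so `det B` is real and the Jacobian `|det B|²` equals
  -- `det M`.
  set B := CFC.sqrt M with hBdef
  have hBB : B * B = M := CFC.sqrt_mul_sqrt_self M hM.posSemidef.nonneg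
  have hBH : Bᴴ = B := (CFC.sqrt_nonneg M).posSemidef.isHermitian
  have hdetM : M.det ≠ 0 := hM.det_pos.ne'
  have hdet2 : B.det * B.det = M.det := by rw [← det_mul, hBB]
  have hB : B.det ≠ 0 := fun h => hdetM (by rw [← hdet2, h, zero_mul])
  have hBu : IsUnit B.det := hB.isUnit
  have hnorm : ‖B.det‖ ^ 2 = M.det.re := by
    have hreal : (starRingEnd ℂ) B.det = B.det := by
      rw [← Complex.star_def, ← det_conjTranspose, hBH]
    have h := Complex.mul_conj B.det
    rw [hreal, hdet2] at h
    rw [h, Complex.ofReal_re, Complex.normSq_eq_norm_sq]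
  have hq : Measurable fun h : Fin n → ℂ => f (star h ⬝ᵥ (M⁻¹ *ᵥ h)).re := by
    refine hf.comp (Continuous.measurable ?_)
    exact Complex.continuous_re.comp (Continuous.dotProduct continuous_star
      (Continuous.matrix_mulVec continuous_const continuous_id))
  rw [lintegral_gaussianVector hq, lintegral_mulVec
    (f := fun h => ENNReal.ofReal (gaussianDensity n h) * f (star h ⬝ᵥ (M⁻¹ *ᵥ h)).re) hB
    ((measurable_ofReal_gaussianDensity n).mul hq), ← lintegral_const_mul']
  · refine lintegral_congr fun g => ?_
    have h1 : (star (B *ᵥ g) ⬝ᵥ (M⁻¹ *ᵥ (B *ᵥ g))).re = normSqSum g := by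
      rw [star_mulVec_dotProduct, mulVec_mulVec, mulVec_mulVec, hBH, ← hBB, Matrix.mul_inv_rev,
        mul_nonsing_inv_cancel_left _ _ hBu, nonsing_inv_mul _ hBu, one_mulVec, star_dotProduct_self, Complex.ofReal_re]
    rw [h1, gaussianDensity, normSqSum_mulVec, hBH, hBB, ← hnorm, ← mul_assoc,
      ← ENNReal.ofReal_mul (by positivity), mul_comm]
    congr 2
    ring
  · exact ENNReal.ofReal_ne_top

/-- Every vector is a nonnegative multiple of the image of the first basis vector under some
unitary matrix. -/
lemma exists_unitary_mulVec_single {N : ℕ} (g : Fin (N + 1) → ℂ) :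
    ∃ U : Matrix (Fin (N + 1)) (Fin (N + 1)) ℂ, Uᴴ * U = 1 ∧
      U *ᵥ Pi.single 0 ((√(normSqSum g) : ℝ) : ℂ) = g := by
  by_cases hg : g = 0
  · refine ⟨1, by simp, ?_⟩
    subst hg
    simp [normSqSum]
  · set x : EuclideanSpace ℂ (Fin (N + 1)) := WithLp.toLp 2 g with hx
    have hx0 : x ≠ 0 := by simpa [hx] using hg
    have hnx : ‖x‖ = √(normSqSum g) := by rw [EuclideanSpace.norm_eq]; rfl
    have hn0 : ‖x‖ ≠ 0 := norm_ne_zero_iff.mpr hx0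
    -- The normalized vector, as a one-element family at index `0`, extends to an orthonormal basis
    -- that forms the columns of `U`.
    have hv : Orthonormal ℂ (({0} : Set (Fin (N + 1))).domRestrict
        fun _ : Fin (N + 1) => ((‖x‖ : ℂ)⁻¹ • x)) := by
      constructor
      · rintro ⟨i, hi⟩
        simp [norm_smul, hn0]
      · rintro ⟨i, hi⟩ ⟨j, hj⟩ hij
        exact absurd (Subtype.ext ((Set.mem_singleton_iff.mp hi).trans
          (Set.mem_singleton_iff.mp hj).symm)) hij
    obtain ⟨b, hb⟩ := hv.exists_orthonormalBasis_extension_of_card_eq (by simp)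
    have hb0 := hb 0 rfl
    refine ⟨Matrix.of fun i j => b j i, ?_, ?_⟩
    · ext i j
      have := orthonormal_iff_ite.mp b.orthonormal i j
      rw [PiLp.inner_apply] at this
      simp only [Matrix.mul_apply, conjTranspose_apply, of_apply, Matrix.one_apply]
      rw [← this]
      refine Finset.sum_congr rfl fun k _ => ?_
      rw [RCLike.inner_apply, mul_comm]; rfl
    · funext i
      have hn : (‖x‖ : ℂ) ≠ 0 := by exact_mod_cast hn0
      have hcol : (b 0).ofLp i = (‖x‖ : ℂ)⁻¹ * g i := by rw [hb0]; rfl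
      rw [← hnx, mulVec_single]
      simp only [Pi.smul_apply, col_apply, of_apply, hcol, MulOpposite.smul_eq_mul_unop,
        MulOpposite.unop_op]
      field_simp

/-! ### Exponential tilting and the averaged determinant -/

section Tilting

/-- Inverse variances of a Gaussian vector whose first coordinate is tilted. -/
noncomputable def tiltedPrecision (N : ℕ) (t : ℝ) (i : Fin (N + 1)) : ℝ := if i = 0 then 1 + t else 1

lemma tiltedPrecision_pos {N : ℕ} {t : ℝ} (ht : 0 ≤ t) (i : Fin (N + 1)) :
    0 < tiltedPrecision N t i := by
  unfold tiltedPrecision; split_ifs <;> linarith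

/-- The law of a Gaussian vector whose first coordinate has variance `1 / (1 + t)`, the others
having unit variance. -/
noncomputable def tiltedVector (N : ℕ) (t : ℝ) : Measure (Fin (N + 1) → ℂ) :=
  Measure.pi fun i => circularGaussian (tiltedPrecision N t i)

lemma isProbabilityMeasure_tiltedVector (N : ℕ) {t : ℝ} (ht : 0 ≤ t) :
    IsProbabilityMeasure (tiltedVector N t) := by
  have := fun i => isProbabilityMeasure_circularGaussian (tiltedPrecision_pos (N := N) ht i)
  unfold tiltedVector; infer_instance

lemma circularGaussian_eq_withDensity (b : ℝ) :
    circularGaussian b = complexGaussian.withDensity fun z =>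
      ENNReal.ofReal (b * Real.exp (-(b - 1) * ‖z‖ ^ 2)) := by
  rw [complexGaussian_eq, circularGaussian, circularGaussian,
    ← withDensity_mul _ (measurable_circularGaussian_density 1) (by fun_prop)]
  congr 1
  funext z
  have := Real.pi_pos
  rw [Pi.mul_apply, ← ENNReal.ofReal_mul (by positivity), mul_mul_mul_comm, ← Real.exp_add]
  congr 2
  · ring
  · congr 1; ring

/-- The factor `1 + t` normalizes the tilt; coordinates other than the first have precision `1` and
contribute the factor `1`. -/
lemma tiltedVector_eq (N : ℕ) {t : ℝ} (ht : 0 ≤ t) :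
    tiltedVector N t = (gaussianVector (N + 1)).withDensity fun h =>
      ENNReal.ofReal ((1 + t) * Real.exp (-(t * ‖h 0‖ ^ 2))) := by
  have h1 := fun i => circularGaussian_eq_withDensity (tiltedPrecision N t i)
  have hp := fun i => isProbabilityMeasure_circularGaussian (tiltedPrecision_pos (N := N) ht i)
  have : ∀ i : Fin (N + 1), SigmaFinite (complexGaussian.withDensity fun z =>
      ENNReal.ofReal (tiltedPrecision N t i *
        Real.exp (-(tiltedPrecision N t i - 1) * ‖z‖ ^ 2))) := fun i => by
    rw [← h1]; infer_instance
  unfold tiltedVector gaussianVector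
  simp_rw [h1]
  rw [pi_withDensity (fun _ : Fin (N + 1) => complexGaussian)
    (f := fun i z => ENNReal.ofReal (tiltedPrecision N t i *
        Real.exp (-(tiltedPrecision N t i - 1) * ‖z‖ ^ 2))) (fun i => by fun_prop)]
  congr 1
  funext x
  rw [Fin.prod_univ_succ]
  simp [tiltedPrecision]

end Tilting

lemma interferenceMatrix_mulVec {n m : ℕ} {U : Matrix (Fin n) (Fin n) ℂ} (hU : Uᴴ * U = 1) (a : ℝ)
    (C : Fin m → Fin n → ℂ) :
    interferenceMatrix a (fun j => U *ᵥ C j) = U * interferenceMatrix a C * Uᴴ := by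
  have hU' : U * Uᴴ = 1 := mul_eq_one_comm.mp hU
  simp only [interferenceMatrix, Matrix.mul_add, Matrix.add_mul, Matrix.mul_sum, Matrix.sum_mul,
    Matrix.mul_smul, Matrix.smul_mul, Matrix.mul_one, hU', star_mulVec, mul_vecMulVec,
    vecMulVec_mul]

lemma det_interferenceMatrix_mulVec {n m : ℕ} {U : Matrix (Fin n) (Fin n) ℂ} (hU : Uᴴ * U = 1)
    (a : ℝ) (C : Fin m → Fin n → ℂ) :
    (interferenceMatrix a (fun j => U *ᵥ C j)).det = (interferenceMatrix a C).det := by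
  rw [interferenceMatrix_mulVec hU, det_mul, mul_comm, ← det_mul, ← Matrix.mul_assoc, hU,
    Matrix.one_mul]

lemma continuous_interferenceMatrix {n m : ℕ} (a : ℝ) :
    Continuous fun C : Fin m → Fin n → ℂ => interferenceMatrix a C := by
  unfold interferenceMatrix
  refine continuous_const.add (continuous_finsetSum _ fun j _ => ?_)
  exact Continuous.matrix_vecMulVec (continuous_apply j) (continuous_star.comp (continuous_apply j))

lemma lintegral_det_interferenceMatrix_tilted (N m : ℕ) {a t : ℝ} (ha : 0 < a) (ht : 0 ≤ t) :
    ∫⁻ C : Fin m → Fin (N + 1) → ℂ, ENNReal.ofReal (interferenceMatrix a C).det.re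
        ∂(Measure.pi fun _ => tiltedVector N t) =
      ENNReal.ofReal (meanMinorTilted a (1 / (1 + t)) m N) := by
  have hprob := isProbabilityMeasure_tiltedVector N ht
  have hpos := tiltedPrecision_pos (N := N) ht
  have hint := integrable_mul_star_pi hpos
  have hmom := integral_mul_star_pi hpos
  have hi := integrable_minor (tiltedVector N t) hint a m id id
  have hv := integral_minor_of_tilted (ν := tiltedVector N t)
    (v := fun i => 1 / tiltedPrecision N t i) hint hmom a (w := 1 / (1 + t)) m id
    Function.injective_id (by simp [tiltedPrecision]) (by simp [tiltedPrecision])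
  simp only [submatrix_id_id] at hi hv
  have hre : Integrable (fun C : Fin m → Fin (N + 1) → ℂ => (interferenceMatrix a C).det.re)
    (Measure.pi fun _ => tiltedVector N t) := hi.re
  rw [← ofReal_integral_eq_lintegral_ofReal hre (Eventually.of_forall fun C =>
    (Complex.lt_def.mp (posDef_interferenceMatrix ha C).det_pos).1.le)]
  have h2 : ∫ C : Fin m → Fin (N + 1) → ℂ, (interferenceMatrix a C).det.re
        ∂(Measure.pi fun _ => tiltedVector N t) = (∫ C : Fin m → Fin (N + 1) → ℂ,
          (interferenceMatrix a C).det ∂(Measure.pi fun _ => tiltedVector N t)).re :=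
    integral_re hi
  rw [h2, hv, Complex.ofReal_re]

/-- The mean of `det M e^{-g† (M - a I) g}` over the interference matrix `M`. -/
lemma lintegral_det_mul_exp (N m : ℕ) {a : ℝ} (ha : 0 < a) (g : Fin (N + 1) → ℂ) :
    ∫⁻ C : Fin m → Fin (N + 1) → ℂ, ENNReal.ofReal ((interferenceMatrix a C).det.re *
        Real.exp (-∑ j, ‖star g ⬝ᵥ C j‖ ^ 2)) ∂(Measure.pi fun _ => gaussianVector (N + 1)) =
      ENNReal.ofReal (meanMinorTilted a (1 / (1 + normSqSum g)) m N / (1 + normSqSum g) ^ m) := by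
  set t := normSqSum g with ht_def
  have ht : 0 ≤ t := normSqSum_nonneg g
  have ht1 : 0 < 1 + t := by linarith
  obtain ⟨U, hU, hUg⟩ := exists_unitary_mulVec_single g
  have hmp : MeasurePreserving (fun (C : Fin m → Fin (N + 1) → ℂ) j => U *ᵥ C j)
      (Measure.pi fun _ => gaussianVector (N + 1)) (Measure.pi fun _ => gaussianVector (N + 1)) :=
    measurePreserving_pi _ _ fun _ => measurePreserving_mulVec_gaussianVector hU
  have hdetc : Continuous fun C : Fin m → Fin (N + 1) → ℂ => (interferenceMatrix a C).det.re :=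
    Complex.continuous_re.comp (continuous_interferenceMatrix a).matrix_det
  have hmeas : Measurable fun C : Fin m → Fin (N + 1) → ℂ =>
      ENNReal.ofReal ((interferenceMatrix a C).det.re *
        Real.exp (-∑ j, ‖star g ⬝ᵥ C j‖ ^ 2)) := by
    refine ENNReal.measurable_ofReal.comp (Continuous.measurable ?_)
    refine hdetc.mul (Real.continuous_exp.comp (Continuous.neg ?_))
    refine continuous_finsetSum _ fun j _ => ((Continuous.dotProduct continuous_const
      (continuous_apply j)).norm.pow 2)
  have hprob := isProbabilityMeasure_tiltedVector N ht
  have : SigmaFinite ((gaussianVector (N + 1)).withDensity fun h =>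
      ENNReal.ofReal ((1 + t) * Real.exp (-(t * ‖h 0‖ ^ 2)))) := by
    rw [← tiltedVector_eq N ht]; infer_instance
  have hwm : Measurable fun h : Fin (N + 1) → ℂ =>
      ENNReal.ofReal ((1 + t) * Real.exp (-(t * ‖h 0‖ ^ 2))) := by fun_prop
  have hpi : (Measure.pi fun _ : Fin m => tiltedVector N t) =
      (Measure.pi fun _ : Fin m => gaussianVector (N + 1)).withDensity fun C =>
        ∏ j, ENNReal.ofReal ((1 + t) * Real.exp (-(t * ‖C j 0‖ ^ 2))) := by
    rw [tiltedVector_eq N ht]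
    exact pi_withDensity (fun _ : Fin m => gaussianVector (N + 1)) (f := fun _ h =>
        ENNReal.ofReal ((1 + t) * Real.exp (-(t * ‖h 0‖ ^ 2)))) fun _ => hwm
  have hwm' : Measurable fun C : Fin m → Fin (N + 1) → ℂ =>
      ∏ j, ENNReal.ofReal ((1 + t) * Real.exp (-(t * ‖C j 0‖ ^ 2))) :=
    Finset.measurable_prod _ fun j _ => hwm.comp (measurable_pi_apply j)
  -- After rotation `g` becomes `√t e₀`, so the exponent sees only the first coordinate of each
  -- column.
  have hgC : ∀ (C : Fin m → Fin (N + 1) → ℂ) j, ‖star g ⬝ᵥ (U *ᵥ C j)‖ ^ 2 = t * ‖C j 0‖ ^ 2 := by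
    intro C j
    have : star g ⬝ᵥ (U *ᵥ C j) = ((√t : ℝ) : ℂ) * C j 0 := by
      rw [← hUg, star_mulVec_dotProduct, mulVec_mulVec, hU, one_mulVec, ← Pi.single_star,
        single_dotProduct, Complex.star_def, Complex.conj_ofReal]
    rw [this, norm_mul, mul_pow, Complex.norm_real, Real.norm_eq_abs, sq_abs, Real.sq_sqrt ht]
  rw [← hmp.lintegral_comp hmeas, div_eq_inv_mul, ENNReal.ofReal_mul (by positivity),
    ← lintegral_det_interferenceMatrix_tilted N m ha ht, hpi,
    lintegral_withDensity_eq_lintegral_mul _ hwm'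
      (g := fun C => ENNReal.ofReal (interferenceMatrix a C).det.re) (ENNReal.measurable_ofReal.comp hdetc.measurable),
    ← lintegral_const_mul' _ _ ENNReal.ofReal_ne_top]
  refine lintegral_congr fun C => ?_
  have hdet0 : 0 ≤ (interferenceMatrix a C).det.re :=
    (Complex.lt_def.mp (posDef_interferenceMatrix ha C).det_pos).1.le
  simp only [Pi.mul_apply, hgC, det_interferenceMatrix_mulVec hU]
  rw [← ENNReal.ofReal_prod_of_nonneg fun i _ => by positivity, ← ENNReal.ofReal_mul (by positivity),
    ← ENNReal.ofReal_mul (by positivity), Finset.prod_mul_distrib, ← Real.exp_sum,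
    Finset.sum_neg_distrib]
  congr 1
  simp only [Finset.prod_const, Finset.card_univ, Fintype.card_fin]
  field_simp

/-! ### Law of the quadratic form -/

/-- The quadratic form `h† (a I + ∑ⱼ cⱼ cⱼ†)⁻¹ h`. -/
noncomputable def quadForm {n m : ℕ} (a : ℝ) (p : (Fin n → ℂ) × (Fin m → Fin n → ℂ)) : ℝ :=
  (star p.1 ⬝ᵥ ((interferenceMatrix a p.2)⁻¹ *ᵥ p.1)).re

lemma measurable_quadForm {n m : ℕ} (a : ℝ) :
    Measurable (quadForm a : (Fin n → ℂ) × (Fin m → Fin n → ℂ) → ℝ) := by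
  -- Writing the inverse as `det⁻¹` times the adjugate separates a measurable factor from a
  -- continuous one.
  have h : (quadForm a : (Fin n → ℂ) × (Fin m → Fin n → ℂ) → ℝ) = fun p =>
      ((interferenceMatrix a p.2).det⁻¹ *
        (star p.1 ⬝ᵥ ((interferenceMatrix a p.2).adjugate *ᵥ p.1))).re := by
    funext p
    rw [quadForm, Matrix.inv_def, Ring.inverse_eq_inv', smul_mulVec, dotProduct_smul, smul_eq_mul]
  rw [h]
  have hM : Continuous fun p : (Fin n → ℂ) × (Fin m → Fin n → ℂ) => interferenceMatrix a p.2 :=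
    (continuous_interferenceMatrix a).comp continuous_snd
  refine Complex.measurable_re.comp ((hM.matrix_det.measurable.inv).mul (Continuous.measurable ?_))
  exact Continuous.dotProduct (continuous_star.comp continuous_fst)
    (hM.matrix_adjugate.matrix_mulVec continuous_fst)

lemma dotProduct_interferenceMatrix_mulVec {n m : ℕ} (a : ℝ) (C : Fin m → Fin n → ℂ)
    (g : Fin n → ℂ) :
    (star g ⬝ᵥ (interferenceMatrix a C *ᵥ g)).re =
      a * normSqSum g + ∑ j, ‖star g ⬝ᵥ C j‖ ^ 2 := by
  have h : star g ⬝ᵥ (interferenceMatrix a C *ᵥ g) =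
      ((a * normSqSum g + ∑ j, ‖star g ⬝ᵥ C j‖ ^ 2 : ℝ) : ℂ) := by
    rw [interferenceMatrix, add_mulVec, smul_mulVec, one_mulVec, dotProduct_add, dotProduct_smul,
      star_dotProduct_self, sum_mulVec, dotProduct_sum]
    push_cast
    rw [smul_eq_mul]
    congr 1
    refine Finset.sum_congr rfl fun j _ => ?_
    rw [vecMulVec_mulVec, dotProduct_smul, ← Complex.ofReal_pow, ← Complex.normSq_eq_norm_sq,
      ← Complex.mul_conj, ← Complex.star_def, ← star_dotProduct_star, star_star]
    simp
  rw [h, Complex.ofReal_re]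

/-- The density of `quadForm` under Gaussian inputs, up to the volume of spheres. -/
noncomputable def radialDensity (N m : ℕ) (a t : ℝ) : ℝ :=
  Real.exp (-(a * t)) * (meanMinorTilted a (1 / (1 + t)) m N / (1 + t) ^ m)

/-- Whitening for fixed `C` frees the argument of `f` from `C`, so after Tonelli only the weight is
averaged over `C`. -/
lemma lintegral_quadForm (N m : ℕ) {a : ℝ} (ha : 0 < a) {f : ℝ → ℝ≥0∞} (hf : Measurable f) :
    ∫⁻ p : (Fin (N + 1) → ℂ) × (Fin m → Fin (N + 1) → ℂ), f (quadForm a p)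
        ∂((gaussianVector (N + 1)).prod (Measure.pi fun _ => gaussianVector (N + 1))) =
      ∫⁻ g : Fin (N + 1) → ℂ, f (normSqSum g) *
        ENNReal.ofReal (Real.pi⁻¹ ^ (N + 1) * radialDensity N m a (normSqSum g)) := by
  rw [lintegral_prod_symm (fun p => f (quadForm a p)) (hf.comp (measurable_quadForm a)).aemeasurable]
  have h1 : ∀ C : Fin m → Fin (N + 1) → ℂ, _ := fun C =>
    lintegral_gaussianVector_quadratic_form (posDef_interferenceMatrix ha C) hf
  simp only [quadForm, h1]
  rw [lintegral_lintegral_swap]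
  · refine lintegral_congr fun g => ?_
    have h2 : ∀ C : Fin m → Fin (N + 1) → ℂ, f (normSqSum g) * ENNReal.ofReal
        (Real.pi⁻¹ ^ (N + 1) * ((interferenceMatrix a C).det.re *
          Real.exp (-(star g ⬝ᵥ (interferenceMatrix a C *ᵥ g)).re))) =
        f (normSqSum g) * ENNReal.ofReal (Real.pi⁻¹ ^ (N + 1) * Real.exp (-(a * normSqSum g))) *
          ENNReal.ofReal ((interferenceMatrix a C).det.re *
            Real.exp (-∑ j, ‖star g ⬝ᵥ C j‖ ^ 2)) := by
      intro C
      have := Real.pi_pos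
      rw [dotProduct_interferenceMatrix_mulVec, neg_add, Real.exp_add, mul_assoc,
        ← ENNReal.ofReal_mul (by positivity)]
      congr 2
      ring
    simp only [h2]
    rw [lintegral_const_mul, lintegral_det_mul_exp N m ha g, mul_assoc,
      ← ENNReal.ofReal_mul (by have := Real.pi_pos; positivity), radialDensity, mul_assoc]
    refine ENNReal.measurable_ofReal.comp (Continuous.measurable ?_)
    refine (Complex.continuous_re.comp (continuous_interferenceMatrix a).matrix_det).mul
      (Real.continuous_exp.comp (Continuous.neg ?_))
    exact continuous_finsetSum _ fun j _ => ((Continuous.dotProduct continuous_const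
      (continuous_apply j)).norm.pow 2)
  · refine Measurable.aemeasurable ?_
    refine (hf.comp (continuous_normSqSum.measurable.comp measurable_snd)).mul
      (ENNReal.measurable_ofReal.comp (Continuous.measurable ?_))
    have hM : Continuous fun p : (Fin m → Fin (N + 1) → ℂ) × (Fin (N + 1) → ℂ) =>
        interferenceMatrix a p.1 := (continuous_interferenceMatrix a).comp continuous_fst
    refine continuous_const.mul ((Complex.continuous_re.comp hM.matrix_det).mul
      (Real.continuous_exp.comp (Continuous.neg (Complex.continuous_re.comp ?_))))
    exact Continuous.dotProduct (continuous_star.comp continuous_snd)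
      (hM.matrix_mulVec continuous_snd)

/-- Integration of radial functions over `ℂ^(N+1)`. -/
lemma exists_integral_normSqSum (N : ℕ) : ∃ K : ℝ, ∀ φ : ℝ → ℝ,
    ∫ g : Fin (N + 1) → ℂ, φ (normSqSum g) =
      K * ∫ r in Set.Ioi (0 : ℝ), r ^ (2 * N + 1) * φ (r ^ 2) := by
  set e : (Fin (N + 1) → ℂ) ≃L[ℝ] EuclideanSpace ℂ (Fin (N + 1)) :=
    (PiLp.continuousLinearEquiv 2 ℝ fun _ : Fin (N + 1) => ℂ).symm
  set μ : Measure (EuclideanSpace ℂ (Fin (N + 1))) := (volume : Measure (Fin (N + 1) → ℂ)).map e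
    with hμ
  have : μ.IsAddHaarMeasure := e.isAddHaarMeasure_map volume
  have hdim : Module.finrank ℝ (EuclideanSpace ℂ (Fin (N + 1))) = 2 * (N + 1) := by
    rw [← Module.finrank_mul_finrank ℝ ℂ, Complex.finrank_real_complex]
    simp
  -- Polar coordinates in real dimension `2 (N + 1)`: the constant is the dimension times the volume
  -- of the unit ball.
  refine ⟨(2 * (N + 1) : ℕ) * μ.real (Metric.ball 0 1), fun φ => ?_⟩
  have h := integral_fun_norm_addHaar μ (fun r : ℝ => φ (r ^ 2))
  rw [hdim, show 2 * (N + 1) - 1 = 2 * N + 1 by omega] at h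
  simp only [nsmul_eq_mul, smul_eq_mul] at h
  rw [mul_assoc, ← h]
  refine Eq.trans ?_ (e.toHomeomorph.measurableEmbedding.integral_map (μ := volume)
    (fun x => φ (‖x‖ ^ 2))).symm
  refine integral_congr_ae (Eventually.of_forall fun g => ?_)
  have : ‖e g‖ ^ 2 = normSqSum g := by
    rw [EuclideanSpace.norm_sq_eq]; rfl
  exact congrArg φ this.symm

lemma radialDensity_nonneg (N m : ℕ) {a t : ℝ} (ha : 0 < a) (ht : 0 ≤ t) :
    0 ≤ radialDensity N m a t := by
  have := meanMinorTilted_nonneg ha.le (w := 1 / (1 + t)) (by positivity) m N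
  unfold radialDensity; positivity

lemma measurable_meanMinorTilted (a : ℝ) (m k : ℕ) :
    Measurable fun w => meanMinorTilted a w m k := by
  induction m generalizing k with
  | zero => simp only [meanMinorTilted]; exact measurable_const
  | succ m ih =>
    simp only [meanMinorTilted]
    have := ih k
    have := ih (k - 1)
    fun_prop

lemma measurable_radialDensity (N m : ℕ) (a : ℝ) : Measurable (radialDensity N m a) := by
  unfold radialDensity
  have : Measurable fun t : ℝ => meanMinorTilted a (1 / (1 + t)) m N :=
    (measurable_meanMinorTilted a m N).comp (by fun_prop)
  fun_prop

lemma integral_Ioi_radialDensity (N m : ℕ) {a z : ℝ} (ha : 0 < a) (hz : 0 ≤ z) :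
    ∫ r in Set.Ioi (√z), r ^ (2 * N + 1) * radialDensity N m a (r ^ 2) =
      N.factorial / 2 * F (N + 1) (m + 1) a z := by
  have h := integral_Ioi_of_hasDerivAt_of_nonpos' (a := √z)
    (fun r _ => hasDerivAt_F_sq m N a r)
    (fun r hr => by
      have hr0 : 0 ≤ r := (Real.sqrt_nonneg z).trans (Set.mem_Ioi.mp hr).le
      have : 0 ≤ radialDensity N m a (r ^ 2) := radialDensity_nonneg N m ha (sq_nonneg r)
      unfold radialDensity at this
      exact neg_nonpos.mpr (by positivity))
    ((tendsto_F m (N + 1) ha).comp (tendsto_pow_atTop two_ne_zero))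
  rw [integral_neg, integral_const_mul, Real.sq_sqrt hz, zero_sub, neg_inj] at h
  rw [← h]
  have : (N.factorial : ℝ) ≠ 0 := by positivity
  unfold radialDensity
  field_simp

/-- Letting `S` lie between `Ioi z` and `Ici z` treats strict and weak tails together; they differ
on the null radius `r = √z`. `K` is chosen before `z` so that one value of `z` can determine it. -/
lemma measureReal_quadForm_mem_aux (N m : ℕ) {a : ℝ} (ha : 0 < a) : ∃ K : ℝ, ∀ z : ℝ, 0 ≤ z →
    ∀ S : Set ℝ, MeasurableSet S → Set.Ioi z ⊆ S → S ⊆ Set.Ici z →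
    ((gaussianVector (N + 1)).prod (Measure.pi fun _ : Fin m => gaussianVector (N + 1))).real
      (quadForm a ⁻¹' S) = K * F (N + 1) (m + 1) a z := by
  obtain ⟨K, hK⟩ := exists_integral_normSqSum N
  have hpi := Real.pi_pos
  refine ⟨K * (Real.pi⁻¹ ^ (N + 1) * (N.factorial / 2)), fun z hz S hS hS1 hS2 => ?_⟩
  have hone : Measurable (S.indicator (1 : ℝ → ℝ≥0∞)) := measurable_one.indicator hS
  have h1 : ((gaussianVector (N + 1)).prod
      (Measure.pi fun _ : Fin m => gaussianVector (N + 1))) (quadForm a ⁻¹' S) =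
      ∫⁻ g : Fin (N + 1) → ℂ, ENNReal.ofReal (S.indicator
        (fun t => Real.pi⁻¹ ^ (N + 1) * radialDensity N m a t) (normSqSum g)) := by
    rw [← lintegral_indicator_one (measurable_quadForm a hS)]
    refine (lintegral_quadForm N m ha hone).trans (lintegral_congr fun g => ?_)
    by_cases hg : normSqSum g ∈ S <;> simp [hg]
  have hmeas : Measurable (S.indicator fun t => Real.pi⁻¹ ^ (N + 1) * radialDensity N m a t) :=
    ((measurable_radialDensity N m a).const_mul _).indicator hS
  have hreal : ∫ g : Fin (N + 1) → ℂ, S.indicator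
      (fun t => Real.pi⁻¹ ^ (N + 1) * radialDensity N m a t) (normSqSum g) = _ :=
    integral_eq_lintegral_of_nonneg_ae (Eventually.of_forall fun g =>
      Set.indicator_apply_nonneg fun _ =>
        mul_nonneg (by positivity) (radialDensity_nonneg N m ha (normSqSum_nonneg g)))
    (hmeas.comp continuous_normSqSum.measurable).aestronglyMeasurable
  rw [measureReal_def, h1, ← hreal, hK]
  have h2 : ∫ r in Set.Ioi (0 : ℝ), r ^ (2 * N + 1) *
      S.indicator (fun t => Real.pi⁻¹ ^ (N + 1) * radialDensity N m a t) (r ^ 2) =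
      ∫ r in Set.Ioi (0 : ℝ), (Set.Ioi (√z)).indicator (fun r => Real.pi⁻¹ ^ (N + 1) *
        (r ^ (2 * N + 1) * radialDensity N m a (r ^ 2))) r := by
    refine setIntegral_congr_ae measurableSet_Ioi ?_
    have hne : ∀ᵐ r : ℝ, r ≠ √z := by
      rw [ae_iff]; simp
    filter_upwards [hne] with r hr hr0
    have hr0 : 0 < r := hr0
    by_cases hlt : √z < r
    · have hz2 : z < r ^ 2 := (Real.sqrt_lt' hr0).mp hlt
      rw [Set.indicator_of_mem (hS1 hz2), Set.indicator_of_mem (Set.mem_Ioi.mpr hlt)]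
      ring
    · have hlt' : r < √z := lt_of_le_of_ne (not_lt.mp hlt) hr
      have hz2 : r ^ 2 < z := (Real.lt_sqrt hr0.le).mp hlt'
      rw [Set.indicator_of_notMem (fun h => absurd (hS2 h) (not_le.mpr hz2)),
        Set.indicator_of_notMem (by simpa using hlt), mul_zero]
  rw [h2, setIntegral_indicator measurableSet_Ioi,
    Set.inter_eq_right.mpr (Set.Ioi_subset_Ioi (Real.sqrt_nonneg z)), integral_const_mul,
    integral_Ioi_radialDensity N m ha hz]
  ring

lemma quadForm_nonneg {n m : ℕ} {a : ℝ} (ha : 0 < a) (p : (Fin n → ℂ) × (Fin m → Fin n → ℂ)) :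
    0 ≤ quadForm a p :=
  (Complex.le_def.mp
    ((posDef_interferenceMatrix ha p.2).posSemidef.inv.dotProduct_mulVec_nonneg p.1)).1

/-- The tail of `h† (a I + ∑ⱼ cⱼ cⱼ†)⁻¹ h` for independent standard Gaussian vectors. -/
lemma measureReal_quadForm_mem (N m : ℕ) {a z : ℝ} (ha : 0 < a) (hz : 0 ≤ z) {S : Set ℝ}
    (hS : MeasurableSet S) (hS1 : Set.Ioi z ⊆ S) (hS2 : S ⊆ Set.Ici z) :
    ((gaussianVector (N + 1)).prod (Measure.pi fun _ : Fin m => gaussianVector (N + 1))).real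
      (quadForm a ⁻¹' S) = F (N + 1) (m + 1) a z := by
  obtain ⟨K, hK⟩ := measureReal_quadForm_mem_aux N m ha
  -- At `z = 0` the event is everything and `F = 1`, which forces `K = 1`.
  have h0 := hK 0 le_rfl (Set.Ici 0) measurableSet_Ici Set.Ioi_subset_Ici_self subset_rfl
  have huniv : (quadForm a ⁻¹' Set.Ici 0 :
      Set ((Fin (N + 1) → ℂ) × (Fin m → Fin (N + 1) → ℂ))) = Set.univ :=
    Set.eq_univ_of_forall fun p => quadForm_nonneg ha p
  rw [huniv, F_at_zero, probReal_univ, mul_one] at h0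
  rw [hK z hz S hS hS1 hS2, ← h0, one_mul]

/-! ### From the Rayleigh matrix to independent columns -/

section Transposition

lemma measurePreserving_curry_pi (n k : ℕ) (γ : Measure ℂ) [IsProbabilityMeasure γ] :
    MeasurePreserving (MeasurableEquiv.curry (Fin n) (Fin k) ℂ) (Measure.pi fun _ => γ)
      (Measure.pi fun _ => Measure.pi fun _ => γ) := by
  refine ⟨MeasurableEquiv.measurable _, ?_⟩
  have h := Measure.infinitePi_map_curry (ι := Fin n) (κ := Fin k) fun _ _ => γ
  simpa only [Measure.infinitePi_eq_pi] using h

/-- The unitary matrix acts on rows, while the quadratic form needs the law of the columns. -/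
lemma measurePreserving_transpose_pi (n k : ℕ) (γ : Measure ℂ) [IsProbabilityMeasure γ] :
    MeasurePreserving (fun (X : Fin n → Fin k → ℂ) (j : Fin k) (i : Fin n) => X i j)
      (Measure.pi fun _ => Measure.pi fun _ => γ) (Measure.pi fun _ => Measure.pi fun _ => γ) := by
  have hswap := measurePreserving_piCongrLeft (fun _ : Fin k × Fin n => γ)
    (Equiv.prodComm (Fin n) (Fin k))
  have h := (measurePreserving_curry_pi k n γ).comp
    (hswap.comp (measurePreserving_curry_pi n k γ).symm)
  convert h using 1
  funext X j i
  simp [MeasurableEquiv.piCongrLeft, Equiv.piCongrLeft]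

end Transposition

/-- A matrix split into its first column and the family of its other columns. -/
def splitColumns {n m : ℕ} (X : Fin n → Fin (m + 1) → ℂ) : (Fin n → ℂ) × (Fin m → Fin n → ℂ) :=
  (fun i => X i 0, fun j i => X i j.succ)

/-- The columns of a Rayleigh matrix in a unitary basis are independent Gaussian vectors. -/
lemma IsRayleigh.hasLaw_splitColumns {Ω : Type*} [MeasurableSpace Ω] {μ : Measure Ω}
    [IsProbabilityMeasure μ] {n m : ℕ} {H : Ω → Matrix (Fin n) (Fin (m + 1)) ℂ}
    (hH : IsRayleigh H μ) {V : Matrix (Fin (m + 1)) (Fin (m + 1)) ℂ} (hV : Vᴴ * V = 1) :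
    HasLaw (fun ω => splitColumns (H ω * V))
      ((gaussianVector n).prod (Measure.pi fun _ => gaussianVector n)) μ := by
  have hflat : HasLaw (fun ω (p : Fin n × Fin (m + 1)) => H ω p.1 p.2)
      (Measure.pi fun _ => complexGaussian) μ := by
    refine ⟨aemeasurable_pi_lambda _ fun p => (hH.hasLaw p.1 p.2).aemeasurable, ?_⟩
    rw [(iIndepFun_iff_map_fun_eq_pi_map fun p : Fin n × Fin (m + 1) =>
      (hH.hasLaw p.1 p.2).aemeasurable).mp hH.indep]
    simp only [(hH.hasLaw _ _).map_eq]
  -- Each row of `H V` is `Vᵀ` applied to the corresponding row of `H`.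
  have hVt : (Vᵀ)ᴴ * Vᵀ = 1 := by
    rw [show (Vᵀ)ᴴ = (Vᴴ)ᵀ from rfl, ← transpose_mul, mul_eq_one_comm.mp hV, transpose_one]
  have hrows : MeasurePreserving (fun (X : Fin n → Fin (m + 1) → ℂ) i => Vᵀ *ᵥ X i)
      (Measure.pi fun _ => gaussianVector (m + 1)) (Measure.pi fun _ => gaussianVector (m + 1)) :=
    measurePreserving_pi _ _ fun _ => measurePreserving_mulVec_gaussianVector hVt
  have hall := (measurePreserving_pi_uncons (gaussianVector n) m).comp
    ((measurePreserving_transpose_pi n (m + 1) complexGaussian).comp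
      (hrows.comp (measurePreserving_curry_pi n (m + 1) complexGaussian)))
  have h := hall.hasLaw.comp hflat
  convert h using 1
  funext ω
  have hmul : ∀ i j, (H ω * V) i j = (Vᵀ *ᵥ (fun j => H ω i j)) j := fun i j => by
    rw [mulVec_transpose]; rfl
  simp only [splitColumns, hmul]
  rfl

/-- The unitary matrix whose first column is the MRT precoder, followed by the artificial-noise
precoder. -/
noncomputable def precoderMatrix {m : ℕ} (h : EuclideanSpace ℂ (Fin (m + 1)))
    (G : Matrix (Fin (m + 1)) (Fin m) ℂ) : Matrix (Fin (m + 1)) (Fin (m + 1)) ℂ :=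
  Matrix.of fun i => Fin.cons (mrtVector h i) (G i)

lemma precoderMatrix_unitary {m : ℕ} {h : EuclideanSpace ℂ (Fin (m + 1))} (hh : h ≠ 0)
    {G : Matrix (Fin (m + 1)) (Fin m) ℂ} (hG : IsNullspacePrecoder h G) :
    (precoderMatrix h G)ᴴ * precoderMatrix h G = 1 := by
  have hn : (‖h‖ : ℂ) ≠ 0 := by exact_mod_cast norm_ne_zero_iff.mpr hh
  have horth : ∀ j, ∑ i, star (mrtVector h i) * G i j = 0 := by
    intro j
    have h0 : ∑ i, h i * G i j = 0 := congrFun hG.null j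
    have : ∀ i, star (mrtVector h i) * G i j = (‖h‖ : ℂ)⁻¹ * (h i * G i j) := fun i => by
      simp only [mrtVector, star_div₀, Complex.star_def, Complex.conj_ofReal,
        Complex.conj_conj]
      ring
    simp_rw [this, ← Finset.mul_sum, h0, mul_zero]
  ext i j
  rw [Matrix.mul_apply]
  refine Fin.cases ?_ (fun i => ?_) i <;> refine Fin.cases ?_ (fun j => ?_) j
  · have h1 : ∀ k, star (mrtVector h k) * mrtVector h k =
        ((‖h‖ : ℂ) ^ 2)⁻¹ * ((‖h k‖ ^ 2 : ℝ) : ℂ) := fun k => by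
      rw [← Complex.normSq_eq_norm_sq, ← Complex.mul_conj]
      simp only [mrtVector, star_div₀, Complex.star_def, Complex.conj_ofReal,
        Complex.conj_conj]
      field_simp
    simp only [precoderMatrix, conjTranspose_apply, of_apply, Fin.cons_zero, one_apply_eq, h1]
    rw [← Finset.mul_sum, ← Complex.ofReal_sum, ← EuclideanSpace.norm_sq_eq, Complex.ofReal_pow]
    field_simp
  · simpa [precoderMatrix, conjTranspose_apply, (Fin.succ_ne_zero j).symm] using horth j
  · have := congrArg star (horth i)
    simpa [precoderMatrix, conjTranspose_apply, mul_comm] using this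
  · have := congrFun (congrFun hG.orthonormal i) j
    rw [Matrix.mul_apply] at this
    simpa [precoderMatrix, conjTranspose_apply, Matrix.one_apply] using this

/-! ### Reduction of the capacities to the quadratic form -/

lemma a₂_pos {m : ℕ} {P σ : ℝ} (hP : 0 < P) (hσ : 0 < σ) : 0 < a₂ (m + 1) P σ := by
  unfold a₂; positivity

lemma interferenceMatrix_eq_mul_conjTranspose {n m : ℕ} (a : ℝ) (X : Matrix (Fin n) (Fin m) ℂ) :
    interferenceMatrix a (fun j i => X i j) = (a : ℂ) • 1 + X * Xᴴ := by
  rw [interferenceMatrix]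
  congr 1
  ext i k
  rw [Matrix.sum_apply, Matrix.mul_apply]
  rfl

lemma Z₂_eq_quadForm {n m : ℕ} (P σ : ℝ) (h : EuclideanSpace ℂ (Fin (m + 1)))
    (G : Matrix (Fin (m + 1)) (Fin m) ℂ) (H : Matrix (Fin n) (Fin (m + 1)) ℂ) :
    Z₂ P σ h G H = quadForm (a₂ (m + 1) P σ) (splitColumns (H * precoderMatrix h G)) := by
  have h1 : (splitColumns (H * precoderMatrix h G)).1 = H *ᵥ mrtVector h := by
    funext i
    simp [splitColumns, precoderMatrix, Matrix.mul_apply, mulVec, dotProduct]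
  have h2 : (splitColumns (H * precoderMatrix h G)).2 = fun j i => (H * G) i j := by
    funext j i
    simp [splitColumns, precoderMatrix, Matrix.mul_apply]
  rw [quadForm, h1, h2, interferenceMatrix_eq_mul_conjTranspose]
  rfl

lemma Z₂_nonneg {n m : ℕ} {P σ : ℝ} (hP : 0 < P) (hσ : 0 < σ)
    (h : EuclideanSpace ℂ (Fin (m + 1)))
    (G : Matrix (Fin (m + 1)) (Fin m) ℂ) (H : Matrix (Fin n) (Fin (m + 1)) ℂ) :
    0 ≤ Z₂ P σ h G H := by
  rw [Z₂_eq_quadForm]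
  exact quadForm_nonneg (a₂_pos hP hσ) _

/-- The noise matrix is `P • M`, so the power `P` cancels and what remains is a rank-one
perturbation of the identity. -/
lemma eveCapacity_eq {n m : ℕ} (B : ℝ) {P σ : ℝ} (hP : 0 < P) (hσ : 0 < σ)
    (h : EuclideanSpace ℂ (Fin (m + 1)))
    (G : Matrix (Fin (m + 1)) (Fin m) ℂ) (H : Matrix (Fin n) (Fin (m + 1)) ℂ) :
    eveCapacity B P σ h G H = B * Real.logb 2 (1 + Z₂ P σ h G H) := by
  have hPc : (P : ℂ) ≠ 0 := by exact_mod_cast hP.ne'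
  set M : Matrix (Fin n) (Fin n) ℂ :=
    ((a₂ (m + 1) P σ : ℝ) : ℂ) • 1 + (H * G) * (H * G)ᴴ with hM
  have hMpos : M.PosDef := by
    rw [hM, ← interferenceMatrix_eq_mul_conjTranspose]
    exact posDef_interferenceMatrix (a₂_pos hP hσ) _
  have hK : (((m + 1 : ℕ) : ℂ) * (σ : ℂ) ^ 2) • (1 : Matrix (Fin n) (Fin n) ℂ) +
      (P : ℂ) • ((H * G) * (H * G)ᴴ) = (P : ℂ) • M := by
    rw [hM, smul_add, smul_smul, a₂]
    congr 2
    push_cast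
    field_simp
  have hinv : ((P : ℂ) • M)⁻¹ = (P : ℂ)⁻¹ • M⁻¹ :=
    Matrix.inv_eq_left_inv (by
      rw [Matrix.smul_mul, Matrix.mul_smul, smul_smul, inv_mul_cancel₀ hPc, one_smul,
        nonsing_inv_mul _ hMpos.det_pos.ne'.isUnit])
  have hdet : det ((1 : Matrix (Fin n) (Fin n) ℂ) +
      ((P : ℂ) • vecMulVec (H *ᵥ mrtVector h) (star (H *ᵥ mrtVector h))) *
        ((((m + 1 : ℕ) : ℂ) * (σ : ℂ) ^ 2) • (1 : Matrix (Fin n) (Fin n) ℂ) +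
          (P : ℂ) • ((H * G) * (H * G)ᴴ))⁻¹) =
      1 + star (H *ᵥ mrtVector h) ⬝ᵥ (M⁻¹ *ᵥ (H *ᵥ mrtVector h)) := by
    rw [hK, hinv, Matrix.smul_mul, Matrix.mul_smul, smul_smul, mul_inv_cancel₀ hPc, one_smul,
      vecMulVec_mul, det_add_vecMulVec, det_one, adjugate_one, one_mulVec, ← dotProduct_mulVec]
  have hre := congrArg Complex.re hdet
  rw [Complex.add_re, Complex.one_re] at hre
  exact congrArg (fun x => B * Real.logb 2 x) hre

end DownlinkWiretap

open DownlinkWiretap in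
theorem proposition5 {Ω : Type*} [MeasurableSpace Ω] (μ : Measure Ω) [IsProbabilityMeasure μ]
    (Ne Nm : ℕ) (hNe : 1 ≤ Ne)
    (B P σmv σme : ℝ) (hB : 0 < B) (hP : 0 < P) (hσmv : 0 < σmv) (hσme : 0 < σme)
    (h : EuclideanSpace ℂ (Fin Nm)) (hh : h ≠ 0)
    (G : Matrix (Fin Nm) (Fin (Nm - 1)) ℂ) (hG : IsNullspacePrecoder h G)
    (H : Ω → Matrix (Fin Ne) (Fin Nm) ℂ) (hH : IsRayleigh H μ) :
    (∀ z : ℝ, 0 ≤ z →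
      μ.real {ω | z < Z₂ P σme h G (H ω)} = F Ne Nm (a₂ Nm P σme) z ∧
      μ.real {ω | z ≤ Z₂ P σme h G (H ω)} = F Ne Nm (a₂ Nm P σme) z) ∧
    ∀ R : ℝ, 0 ≤ R → R ≤ mainCapacity B P σmv h →
      outageProb μ B P σmv σme h G H R =
        μ.real {ω | mainCapacity B P σmv h - R ≤ eveCapacity B P σme h G (H ω)} ∧
      outageProb μ B P σmv σme h G H R = F Ne Nm (a₂ Nm P σme) (φ₂ B P σmv h R) ∧
      effectiveSecrecyRate μ B P σmv σme h G H R =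
        (1 - F Ne Nm (a₂ Nm P σme) (φ₂ B P σmv h R)) * R := by
  obtain ⟨N, rfl⟩ : ∃ N, Ne = N + 1 := ⟨Ne - 1, by omega⟩
  obtain ⟨m, rfl⟩ : ∃ m, Nm = m + 1 := by
    cases Nm with
    | zero => exact absurd (Subsingleton.elim h 0) hh
    | succ m => exact ⟨m, rfl⟩
  have ha : 0 < a₂ (m + 1) P σme := a₂_pos hP hσme
  have hlaw := hH.hasLaw_splitColumns (precoderMatrix_unitary hh hG)
  have htail : ∀ z : ℝ, 0 ≤ z → ∀ S : Set ℝ, MeasurableSet S → Set.Ioi z ⊆ S → S ⊆ Set.Ici z →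
      μ.real {ω | Z₂ P σme h G (H ω) ∈ S} = F (N + 1) (m + 1) (a₂ (m + 1) P σme) z := by
    intro z hz S hS hS1 hS2
    rw [← measureReal_quadForm_mem N m ha hz hS hS1 hS2, measureReal_def, measureReal_def,
      ← hlaw.map_eq, Measure.map_apply_of_aemeasurable hlaw.aemeasurable (measurable_quadForm _ hS)]
    congr 2
    ext ω
    simp only [Set.mem_ofPred_eq, Set.mem_preimage]
    rw [← Z₂_eq_quadForm]
  refine ⟨fun z hz => ⟨htail z hz (Set.Ioi z) measurableSet_Ioi subset_rfl Set.Ioi_subset_Ici_self,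
    htail z hz (Set.Ici z) measurableSet_Ici Set.Ioi_subset_Ici_self subset_rfl⟩, ?_⟩
  intro R hR hRC
  -- `R ≤ C_{v,d}` places the threshold in the range where the tail formula holds.
  have hφ : 0 ≤ φ₂ B P σmv h R := by
    have : (1 : ℝ) ≤ 2 ^ ((mainCapacity B P σmv h - R) / B) :=
      Real.one_le_rpow one_le_two (div_nonneg (sub_nonneg.mpr hRC) hB.le)
    unfold φ₂; linarith
  have hiff : ∀ ω, mainCapacity B P σmv h - R ≤ eveCapacity B P σme h G (H ω) ↔
      Z₂ P σme h G (H ω) ∈ Set.Ici (φ₂ B P σmv h R) := by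
    intro ω
    have hZ : 0 ≤ Z₂ P σme h G (H ω) := Z₂_nonneg hP hσme h G (H ω)
    rw [eveCapacity_eq B hP hσme h G (H ω), ← div_le_iff₀' hB,
      Real.le_logb_iff_rpow_le one_lt_two (by linarith), Set.mem_Ici, φ₂, sub_le_iff_le_add']
  have hout : outageProb μ B P σmv σme h G H R =
      μ.real {ω | mainCapacity B P σmv h - R ≤ eveCapacity B P σme h G (H ω)} := by
    unfold outageProb secrecyRate
    congr 1
    ext ω
    -- Since `0 ≤ R`, the positive part does not affect the event.
    simp only [Set.mem_ofPred_eq, max_le_iff, hR, and_true]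
    rw [sub_le_comm]
  have hF : outageProb μ B P σmv σme h G H R =
      F (N + 1) (m + 1) (a₂ (m + 1) P σme) (φ₂ B P σmv h R) := by
    rw [hout, ← htail _ hφ (Set.Ici (φ₂ B P σmv h R)) measurableSet_Ici Set.Ioi_subset_Ici_self
      subset_rfl]
    simp only [hiff]
  exact ⟨hout, hF, by rw [effectiveSecrecyRate, hF]⟩
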